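/- **Conventions.** Let $S_n$ be the group of permutations of $[n]=\{1,\dots,n\}$, let $t_{a,b}$ be the transposition of $a$ and $b$, so that $\pi\,t_{a,b}$ is $\pi$ with its values at positions $a$ and $b$ exchanged, and let $\gtrdot$ denote the covering relation of the (strong) Bruhat order on $S_n$. A (reduced) *bumpless pipe dream* is a tiling of the $n\times n$ grid (matrix coordinates) by six kinds of tiles: the r-tile (joining its south and east edges), the j-tile (joining its west and north edges), the cross (one horizontal and one vertical strand), the blank tile, the horizontal strand and the vertical strand, which forms $n$ pipes, each starting vertically at the south edge of the grid and ending horizontally at the east edge of the grid, such that no two pipes cross twice. Number the pipes $1,\dots,n$ by the column in which they start. The bumpless pipe dream belongs to $\pi\in S_n$ if, for every $i$, the pipe that ends in row $i$ is the pipe $\pi(i)$. Let $\mathrm{BPD}(\pi)$ be the set of bumpless pipe dreams of $\pi$, and let $\mathrm{blank}(D)\subseteq[n]\times[n]$ be the set of positions of the blank tiles of $D$. A *decorated* bumpless pipe dream of $\pi$ is a pair $(D,f)$ with $D\in\mathrm{BPD}(\pi)$ and $f:\mathrm{blank}(D)\to\{\mathsf{x},\mathsf{-y}\}$; $\widetilde{\mathrm{BPD}}(\pi)$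 is the set of these. Put $$\mathrm{mon}(D,f)=\prod_{\substack{(i,j)\in\mathrm{blank}(D)\\ f(i,j)=\mathsf{x}}}x_i\ \prod_{\substack{(i,j)\in\mathrm{blank}(D)\\ f(i,j)=\mathsf{-y}}}(-y_j)\ \in\ \mathbb{Z}[x_1,\dots,x_n,y_1,\dots,y_n],$$ $$\mathfrak{S}_\pi(\mathbf{x},\mathbf{-y})=\sum_{D\in\mathrm{BPD}(\pi)}\ \prod_{(i,j)\in\mathrm{blank}(D)}(x_i-y_j).$$ **Theorem.** Let $\pi\in S_n$ and $1\le\alpha<n$ be such that there exists some $l>\alpha$ with $\pi\,t_{\alpha,l}\gtrdot\pi$. Then there exists a bijection $$\widetilde\Phi_\pi:\ \bigl(\{\mathsf{x},\mathsf{-y}\}\times\widetilde{\mathrm{BPD}}(\pi)\bigr)\ \sqcup\coprod_{\substack{k<\alpha\\ \pi t_{k,\alpha}\gtrdot\pi}}\widetilde{\mathrm{BPD}}(\pi\,t_{k,\alpha})\ \longrightarrow\ \coprod_{\substack{l>\alpha\\ \pi t_{\alpha,l}\gtrdot\pi}}\widetilde{\mathrm{BPD}}(\pi\,t_{\alpha,l})$$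 such that for every $(D,f)\in\widetilde{\mathrm{BPD}}(\pi)$ $$\mathrm{mon}(\widetilde\Phi_\pi(\mathsf{x},D,f))=x_\alpha\,\mathrm{mon}(D,f),\qquad \mathrm{mon}(\widetilde\Phi_\pi(\mathsf{-y},D,f))=-y_{\pi(\alpha)}\,\mathrm{mon}(D,f),$$ and, for every $k<\alpha$ with $\pi\,t_{k,\alpha}\gtrdot\pi$ and every $(D,f)\in\widetilde{\mathrm{BPD}}(\pi\,t_{k,\alpha})$, $$\mathrm{mon}(\widetilde\Phi_\pi(D,f))=\mathrm{mon}(D,f).$$ Consequently Monk's rule for double Schubert polynomials holds in the rearranged form $$(x_\alpha-y_{\pi(\alpha)})\,\mathfrak{S}_\pi(\mathbf{x},\mathbf{-y})+\sum_{\substack{k<\alpha\\ \pi t_{k,\alpha}\gtrdot\pi}}\mathfrak{S}_{\pi t_{k,\alpha}}(\mathbf{x},\mathbf{-y})=\sum_{\substack{l>\alpha\\ \pi t_{\alpha,l}\gtrdot\pi}}\mathfrak{S}_{\pi t_{\alpha,l}}(\mathbf{x},\mathbf{-y}).$$ -/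

import Mathlib

noncomputable section

/-! ### Bruhat order on `S_n` -/

/-- Coxeter length of a permutation: its number of inversions. -/
def permLength {n : ℕ} (π : Equiv.Perm (Fin n)) : ℕ :=
  (Finset.univ.filter fun p : Fin n × Fin n => p.1 < p.2 ∧ π p.2 < π p.1).card

/-- The generating relation of the Bruhat order: `σ = π t_{a,b}` and `σ` is longer than `π`. -/
def BruhatStep {n : ℕ} (π σ : Equiv.Perm (Fin n)) : Prop :=
  ∃ a b : Fin n, a ≠ b ∧ σ = π * Equiv.swap a b ∧ permLength π < permLength σ

/-- The strict (strong) Bruhat order. -/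
def BruhatLT {n : ℕ} (π σ : Equiv.Perm (Fin n)) : Prop :=
  Relation.TransGen BruhatStep π σ

/-- The covering relation `σ ⋗ π` of the Bruhat order. -/
def BruhatCovers {n : ℕ} (σ π : Equiv.Perm (Fin n)) : Prop :=
  BruhatLT π σ ∧ ∀ τ, ¬ (BruhatLT π τ ∧ BruhatLT τ σ)

/-! ### Bumpless pipe dreams -/

/-- The six tiles. An `r`-tile joins its south edge to its east edge, a `j`-tile joins its west
edge to its north edge, in a `cross` the two straight strands cross. -/
inductive Tile where
  | r | j | cross | blank | horiz | vert
  deriving DecidableEq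

instance : Fintype Tile where
  elems := {Tile.r, Tile.j, Tile.cross, Tile.blank, Tile.horiz, Tile.vert}
  complete := by intro t; cases t <;> simp

namespace Tile

/-- Does a strand of the tile meet its north edge? -/
def north : Tile → Bool
  | j => true | cross => true | vert => true | r => false | blank => false | horiz => false

/-- Does a strand of the tile meet its south edge? -/
def south : Tile → Bool
  | r => true | cross => true | vert => true | j => false | blank => false | horiz => false

/-- Does a strand of the tile meet its east edge? -/
def east : Tile → Bool
  | r => true | cross => true | horiz => true | j => false | blank => false | vert => false

/-- Does a strand of the tile meet its west edge? -/
def west : Tile → Bool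
  | j => true | cross => true | horiz => true | r => false | blank => false | vert => false

end Tile

/-- A filling of the `n × n` grid with tiles, in matrix coordinates: `D i j` is the tile in row `i`
(from the top) and column `j` (from the left). -/
abbrev TileGrid (n : ℕ) : Type := Fin n → Fin n → Tile

namespace TileGrid

/-- The tiles fit together along the inner edges, no strand reaches the north or the west border,
and there is one strand at each of the `n` edges of the south border and of the east border. -/
structure IsTiling {n : ℕ} (D : TileGrid n) : Prop where
  east_west : ∀ i j j' : Fin n, j.val + 1 = j'.val → (D i j).east = (D i j').west
  south_north : ∀ i i' j : Fin n, i.val + 1 = i'.val → (D i j).south = (D i' j).north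
  north_border : ∀ i j : Fin n, i.val = 0 → (D i j).north = false
  west_border : ∀ i j : Fin n, j.val = 0 → (D i j).west = false
  south_border : ∀ i j : Fin n, i.val + 1 = n → (D i j).south = true
  east_border : ∀ i j : Fin n, j.val + 1 = n → (D i j).east = true

mutual

/-- Travelling from the south border, pipe `p` (the one that starts at the south edge of
column `p`) enters the tile `(i, j)` through the south edge of that tile. -/
inductive EntersSouth {n : ℕ} (D : TileGrid n) (p : Fin n) : Fin n → Fin n → Prop
  | start (i : Fin n) : i.val + 1 = n → EntersSouth D p i p
  | straight (i i' j : Fin n) : i.val + 1 = i'.val → EntersSouth D p i' j →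
      (D i' j = Tile.vert ∨ D i' j = Tile.cross) → EntersSouth D p i j
  | turn (i i' j : Fin n) : i.val + 1 = i'.val → EntersWest D p i' j →
      D i' j = Tile.j → EntersSouth D p i j

/-- Travelling from the south border, pipe `p` enters the tile `(i, j)` through the west edge of
that tile. -/
inductive EntersWest {n : ℕ} (D : TileGrid n) (p : Fin n) : Fin n → Fin n → Prop
  | straight (i j j' : Fin n) : j.val + 1 = j'.val → EntersWest D p i j →
      (D i j = Tile.horiz ∨ D i j = Tile.cross) → EntersWest D p i j'
  | turn (i j j' : Fin n) : j.val + 1 = j'.val → EntersSouth D p i j →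
      D i j = Tile.r → EntersWest D p i j'

end

/-- Pipe `p` ends at the east edge of row `i`. -/
def EndsAt {n : ℕ} (D : TileGrid n) (p i : Fin n) : Prop :=
  ∃ j : Fin n, j.val + 1 = n ∧
    ((EntersWest D p i j ∧ (D i j = Tile.horiz ∨ D i j = Tile.cross)) ∨
      (EntersSouth D p i j ∧ D i j = Tile.r))

/-- In the tile `(i, j)`, pipe `p` runs horizontally, pipe `q` runs vertically, and they cross. -/
def CrossAt {n : ℕ} (D : TileGrid n) (p q : Fin n) (i j : Fin n) : Prop :=
  D i j = Tile.cross ∧ EntersWest D p i j ∧ EntersSouth D q i j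

/-- No two pipes cross twice (whichever of the two is horizontal at each crossing). -/
def IsReduced {n : ℕ} (D : TileGrid n) : Prop :=
  ∀ p q i j i' j' : Fin n, CrossAt D p q i j →
    (CrossAt D p q i' j' ∨ CrossAt D q p i' j') → i = i' ∧ j = j'

/-- The positions of the blank tiles. -/
def blanks {n : ℕ} (D : TileGrid n) : Finset (Fin n × Fin n) :=
  Finset.univ.filter fun b => D b.1 b.2 = Tile.blank

end TileGrid

/-- The reduced bumpless pipe dreams of `π`: for each row `i`, the pipe that ends at row `i` is the
pipe `π i`, which starts at column `π i`. -/
def BPD {n : ℕ} (π : Equiv.Perm (Fin n)) : Type :=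
  {D : TileGrid n // D.IsTiling ∧ D.IsReduced ∧ ∀ i, D.EndsAt (π i) i}

instance {n : ℕ} (π : Equiv.Perm (Fin n)) : Fintype (BPD π) := by
  classical
  unfold BPD
  exact Fintype.ofFinite _

/-! ### Decorated bumpless pipe dreams -/

/-- The two labels `x` and `-y` of a blank tile. -/
inductive BlankLabel where
  | x | negY

/-- Decorated bumpless pipe dreams of `π`: each blank tile carries a label. -/
def DecoratedBPD {n : ℕ} (π : Equiv.Perm (Fin n)) : Type :=
  Σ D : BPD π, (D.1.blanks → BlankLabel)

/-- The ring `ℤ[x_1, …, x_n, y_1, …, y_n]`. -/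
abbrev XYPoly (n : ℕ) : Type := MvPolynomial (Fin n ⊕ Fin n) ℤ

/-- The variable `x_i`. -/
def xVar {n : ℕ} (i : Fin n) : XYPoly n := MvPolynomial.X (Sum.inl i)

/-- The variable `y_j`. -/
def yVar {n : ℕ} (j : Fin n) : XYPoly n := MvPolynomial.X (Sum.inr j)

/-- The factor of a blank tile in row `i`, column `j`: `x_i` or `-y_j`, according to the label. -/
def BlankLabel.factor {n : ℕ} (i j : Fin n) : BlankLabel → XYPoly n
  | x => xVar i
  | negY => - yVar j

/-- The monomial `mon(D, f)`: the product of `x_i` over the blank tiles labelled `x` and of `-y_j`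
over the blank tiles labelled `-y`. -/
def DecoratedBPD.mon {n : ℕ} {π : Equiv.Perm (Fin n)} (E : DecoratedBPD π) : XYPoly n :=
  ∏ b : E.1.1.blanks, (E.2 b).factor b.1.1 b.1.2

/-- The double Schubert polynomial `𝔖_π(x, -y)`, as the sum over bumpless pipe dreams `D` of `π` of
the product of `x_i - y_j` over the blank tiles `(i, j)` of `D`. -/
def doubleSchubert {n : ℕ} (π : Equiv.Perm (Fin n)) : XYPoly n :=
  ∑ D : BPD π, ∏ b ∈ D.1.blanks, (xVar b.1 - yVar b.2)

/-! ### The two sides of the bijection -/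

/-- The `k < α` with `π t_{k,α} ⋗ π`. -/
abbrev LowerIndex {n : ℕ} (π : Equiv.Perm (Fin n)) (α : Fin n) : Type :=
  {k : Fin n // k < α ∧ BruhatCovers (π * Equiv.swap k α) π}

/-- The `l > α` with `π t_{α,l} ⋗ π`. -/
abbrev UpperIndex {n : ℕ} (π : Equiv.Perm (Fin n)) (α : Fin n) : Type :=
  {l : Fin n // α < l ∧ BruhatCovers (π * Equiv.swap α l) π}

instance {n : ℕ} (π : Equiv.Perm (Fin n)) (α : Fin n) : Fintype (LowerIndex π α) := by
  classical
  exact Fintype.ofFinite _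

instance {n : ℕ} (π : Equiv.Perm (Fin n)) (α : Fin n) : Fintype (UpperIndex π α) := by
  classical
  exact Fintype.ofFinite _

end

/-! # Monk's rule for double Schubert polynomials via bumpless pipe dreams

The weight sums of bumpless pipe dreams are computed row by row and satisfy the transition
recursion. With the commutation of the Monk operators this gives Monk's rule. The weights of
decorated bumpless pipe dreams are signed monomials, so Monk's rule determines how often each
weight occurs on both sides, and the weight preserving bijection follows. -/

open Finset

noncomputable section

-- The weight of a decorated bumpless pipe dream is a monomial in the `x_i` and `-y_j`, and the sign
-- of such a monomial is determined by its exponents. Equal monomials therefore never cancel, so an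
-- equality of two weight sums forces every weight to occur equally often on both sides. The
-- bijection then exists without being constructed (`exists_equiv_of_sum_eq`), and everything rests
-- on Monk's rule (`monk`).
--
-- With all covers on one side, Monk's rule says that the double Schubert polynomials form an
-- eigenfunction of the operator `monkOp` at position `α`, with eigenvalue `x_α`. These operators
-- commute (`monkOp_comm`), because signed covers satisfy the three-term relation
-- `coverSign_relation`. At the last position `i` before an increasing tail, the eigenvalue equation
-- is the transition formula, read off from the tiles of a single row (`monkOp_wordPoly_last`). At
-- an earlier position `β`, choose `u` so that `w` is the only upward term of operator `i` at `u`;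
-- its other terms have smaller letters at `i`. Applying the operators `β` and `i` at `u` in both
-- orders gives the equation at `w` by induction (`monkOp_wordPoly`).
--
-- To connect this with pipe dreams, label every pipe by the row where it ends. Reducedness becomes
-- local: in each crossing the horizontal pipe has the larger label (`LineSystem.reduced_iff`). The
-- weight sum can then be computed row by row, and a single row obeys the recursion of `rowPoly`
-- (`rowSum_eq_rowPoly`, `doubleSchubert_eq_wordPoly`).

namespace MonkBPD

-- Covers of words and the relations between signed covers.

/-- The pair of positions `a < b` is a cover of the word `w`: `w a < w b`, and no position between
`a` and `b` carries a value between `w a` and `w b`. -/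
def IsCover (w : ℕ → ℕ) (a b : ℕ) : Prop :=
  a < b ∧ w a < w b ∧ ∀ e, a < e → e < b → w e ≤ w a ∨ w b ≤ w e

/-- The word `w` with the letters at the positions `a` and `b` exchanged. -/
def exch (w : ℕ → ℕ) (a b : ℕ) : ℕ → ℕ := fun e => w (Equiv.swap a b e)

theorem exch_apply (w : ℕ → ℕ) (a b e : ℕ) :
    exch w a b e = if e = a then w b else if e = b then w a else w e := by
  unfold exch
  rw [Equiv.swap_apply_def]
  split_ifs <;> rfl

theorem exch_comm (w : ℕ → ℕ) (a b : ℕ) : exch w a b = exch w b a := by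
  unfold exch
  rw [Equiv.swap_comm]

theorem exch_exch (w : ℕ → ℕ) (a b : ℕ) : exch (exch w a b) a b = w := by
  funext e
  simp [exch]

theorem exch_bijective {w : ℕ → ℕ} (hw : w.Bijective) (a b : ℕ) : (exch w a b).Bijective :=
  hw.comp (Equiv.swap a b).bijective

/-- All three chains end at the same word, a 3-cycle applied to `w`. This is the diamond property of
Bruhat intervals of length two: there are exactly two intermediate words, and the relative order of
the letters decides which one accompanies `exch w a b`. -/
theorem isCover_triple {w : ℕ → ℕ} (hw : w.Injective) {a b c : ℕ} (hab : a < b) (hbc : b < c) :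
    (IsCover w a b ∧ IsCover (exch w a b) b c) ↔
      ((IsCover w b c ∧ IsCover (exch w b c) a c) ∨ (IsCover w a c ∧ IsCover (exch w a c) a b)) := by
  have h := hw.ne (show a ≠ b by omega)
  have h' := hw.ne (show a ≠ c by omega)
  have h'' := hw.ne (show b ≠ c by omega)
  have hA : ∀ e, e ≠ a → w e ≠ w a := fun e he => hw.ne he
  have hB : ∀ e, e ≠ b → w e ≠ w b := fun e he => hw.ne he
  have hC : ∀ e, e ≠ c → w e ≠ w c := fun e he => hw.ne he
  simp only [IsCover, exch_apply]
  constructor <;> grind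

theorem isCover_triple' {w : ℕ → ℕ} (hw : w.Injective) {a b c : ℕ} (hab : a < b) (hbc : b < c) :
    (IsCover w b c ∧ IsCover (exch w b c) a b) ↔
      ((IsCover w a b ∧ IsCover (exch w a b) a c) ∨ (IsCover w a c ∧ IsCover (exch w a c) b c)) := by
  have h := hw.ne (show a ≠ b by omega)
  have h' := hw.ne (show a ≠ c by omega)
  have h'' := hw.ne (show b ≠ c by omega)
  have hA : ∀ e, e ≠ a → w e ≠ w a := fun e he => hw.ne he
  have hB : ∀ e, e ≠ b → w e ≠ w b := fun e he => hw.ne he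
  have hC : ∀ e, e ≠ c → w e ≠ w c := fun e he => hw.ne he
  simp only [IsCover, exch_apply]
  constructor <;> grind

theorem isCover_disjoint {w : ℕ → ℕ} (hw : w.Injective) {a b c d : ℕ} (hac : a ≠ c) (had : a ≠ d)
    (hbc : b ≠ c) (hbd : b ≠ d) (h1 : IsCover w a b) (h2 : IsCover (exch w a b) c d) :
    IsCover w c d ∧ IsCover (exch w c d) a b := by
  have h3 := hw.ne hac
  have h4 := hw.ne had
  have h5 := hw.ne hbc
  have h6 := hw.ne hbd
  simp only [IsCover, exch_apply] at *
  grind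

open Classical in
/-- The sign with which `exch w a b` occurs in the operator of position `a`. -/
def coverSign (w : ℕ → ℕ) (a b : ℕ) : ℤ :=
  if IsCover w a b then 1 else if IsCover w b a then -1 else 0

theorem IsCover.not_swap {w : ℕ → ℕ} {a b : ℕ} (h : IsCover w a b) : ¬ IsCover w b a :=
  fun h' => absurd h.1 (by have := h'.1; omega)

theorem coverSign_swap (w : ℕ → ℕ) (a b : ℕ) : coverSign w b a = - coverSign w a b := by
  unfold coverSign
  by_cases h : IsCover w a b
  · simp [h, h.not_swap]
  · by_cases h' : IsCover w b a <;> simp [h, h']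

open Classical in
theorem coverSign_of_lt (w : ℕ → ℕ) {a b : ℕ} (h : a < b) :
    coverSign w a b = if IsCover w a b then 1 else 0 := by
  have : ¬ IsCover w b a := fun h' => absurd h'.1 (by omega)
  simp [coverSign, this]

theorem coverSign_self (w : ℕ → ℕ) (a : ℕ) : coverSign w a a = 0 := by
  have : ¬ IsCover w a a := fun h' => absurd h'.1 (by omega)
  simp [coverSign, this]

/-- The relation `[ab]² = 0`: after the exchange the two letters are in decreasing order, so the
pair is no longer a cover. -/
theorem coverSign_mul_reverse (w : ℕ → ℕ) (a b : ℕ) :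
    coverSign w a b * coverSign (exch w a b) b a = 0 := by
  have key : ∀ {a b : ℕ}, a < b → IsCover w a b → ¬ IsCover (exch w a b) a b := by
    intro a b hab h h'
    have h1 := h.2.1
    have h2 := h'.2.1
    simp only [exch_apply] at h2
    grind
  rcases lt_trichotomy a b with h | h | h
  · rw [coverSign_swap (exch w a b) a b, coverSign_of_lt _ h, coverSign_of_lt _ h]
    have := key h
    split_ifs <;> simp_all
  · subst h
    simp [coverSign_self]
  · rw [coverSign_swap w b a, exch_comm, coverSign_of_lt _ h, coverSign_of_lt _ h]
    have := key h
    split_ifs <;> simp_all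

theorem coverSign_relation_of_lt {w : ℕ → ℕ} (hw : w.Injective) {a b c : ℕ} (hab : a < b)
    (hbc : b < c) :
    coverSign w a b * coverSign (exch w a b) b c + coverSign w b c * coverSign (exch w b c) c a
      + coverSign w c a * coverSign (exch w c a) a b = 0 := by
  have hac := hab.trans hbc
  rw [coverSign_swap w a c, coverSign_swap (exch w b c) a c, exch_comm w c a]
  simp only [coverSign_of_lt _ hab, coverSign_of_lt _ hbc, coverSign_of_lt _ hac]
  have h := isCover_triple hw hab hbc
  have h' : ¬ ((IsCover w b c ∧ IsCover (exch w b c) a c) ∧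
      (IsCover w a c ∧ IsCover (exch w a c) a b)) := by
    rintro ⟨⟨h1, -⟩, -, h2⟩
    have h3 := h1.2.1
    have h4 := h2.2.1
    simp only [exch_apply] at h4
    grind
  split_ifs <;> simp_all

theorem coverSign_relation_of_lt' {w : ℕ → ℕ} (hw : w.Injective) {a b c : ℕ} (hab : a < b)
    (hbc : b < c) :
    coverSign w a c * coverSign (exch w a c) c b + coverSign w c b * coverSign (exch w c b) b a
      + coverSign w b a * coverSign (exch w b a) a c = 0 := by
  have hac := hab.trans hbc
  rw [coverSign_swap (exch w a c) b c, coverSign_swap w b c, coverSign_swap _ a b,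
    coverSign_swap w a b, exch_comm w c b, exch_comm w b a]
  simp only [coverSign_of_lt _ hab, coverSign_of_lt _ hbc, coverSign_of_lt _ hac]
  have h := isCover_triple' hw hab hbc
  have h' : ¬ ((IsCover w a b ∧ IsCover (exch w a b) a c) ∧
      (IsCover w a c ∧ IsCover (exch w a c) b c)) := by
    rintro ⟨⟨h1, -⟩, -, h2⟩
    have h3 := h1.2.1
    have h4 := h2.2.1
    simp only [exch_apply] at h4
    grind
  split_ifs <;> simp_all

/-- The quadratic relation `[ab][bc] + [bc][ca] + [ca][ab] = 0`. -/
theorem coverSign_relation {w : ℕ → ℕ} (hw : w.Injective) {a b c : ℕ} (hab : a ≠ b)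
    (hbc : b ≠ c) (hac : a ≠ c) :
    coverSign w a b * coverSign (exch w a b) b c + coverSign w b c * coverSign (exch w b c) c a
      + coverSign w c a * coverSign (exch w c a) a b = 0 := by
  -- The relation is invariant under cyclic rotation of `a, b, c`, so the six orders reduce to two.
  rcases lt_or_gt_of_ne hab with h1 | h1 <;> rcases lt_or_gt_of_ne hbc with h2 | h2 <;>
    rcases lt_or_gt_of_ne hac with h3 | h3
  · linarith [coverSign_relation_of_lt hw h1 h2]
  · omega
  · linarith [coverSign_relation_of_lt' hw h3 h2]
  · linarith [coverSign_relation_of_lt hw h3 h1]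
  · linarith [coverSign_relation_of_lt' hw h1 h3]
  · linarith [coverSign_relation_of_lt hw h2 h3]
  · omega
  · linarith [coverSign_relation_of_lt' hw h2 h1]

theorem coverSign_mul_comm {w : ℕ → ℕ} (hw : w.Injective) {a b c d : ℕ} (hac : a ≠ c)
    (had : a ≠ d) (hbc : b ≠ c) (hbd : b ≠ d) :
    coverSign w a b * coverSign (exch w a b) c d
      = coverSign w c d * coverSign (exch w c d) a b := by
  have key : ∀ {a b c d : ℕ}, a ≠ c → a ≠ d → b ≠ c → b ≠ d → a < b → c < d →
      coverSign w a b * coverSign (exch w a b) c d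
      = coverSign w c d * coverSign (exch w c d) a b := by
    intro a b c d hac had hbc hbd hab hcd
    simp only [coverSign_of_lt _ hab, coverSign_of_lt _ hcd]
    have h1 := isCover_disjoint hw hac had hbc hbd
    have h2 := isCover_disjoint hw hac.symm hbc.symm had.symm hbd.symm
    split_ifs <;> simp_all
  rcases lt_trichotomy a b with h | rfl | h
  · rcases lt_trichotomy c d with h' | rfl | h'
    · exact key hac had hbc hbd h h'
    · simp [coverSign_self]
    · rw [coverSign_swap _ d c, coverSign_swap w d c, exch_comm w c d]
      linarith [key had hac hbd hbc h h']
  · simp [coverSign_self]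
  · rcases lt_trichotomy c d with h' | rfl | h'
    · rw [coverSign_swap (exch w c d) b a, coverSign_swap w b a, exch_comm w a b]
      linarith [key hbc hbd hac had h h']
    · simp [coverSign_self]
    · rw [coverSign_swap (exch w c d) b a, coverSign_swap w b a, exch_comm w a b,
        coverSign_swap (exch w b a) d c, coverSign_swap w d c, exch_comm w c d]
      linarith [key hbd hbc had hac h h']

theorem exch_triple (w : ℕ → ℕ) {a b c : ℕ} (hab : a ≠ b) (hbc : b ≠ c) (hac : a ≠ c) :
    exch (exch w a b) b c = exch (exch w b c) c a := by
  funext e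
  simp only [exch_apply]
  grind

theorem exch_disjoint (w : ℕ → ℕ) {a b c d : ℕ} (hac : a ≠ c) (had : a ≠ d) (hbc : b ≠ c)
    (hbd : b ≠ d) : exch (exch w a b) c d = exch (exch w c d) a b := by
  funext e
  simp only [exch_apply]
  grind

-- Commutation of the Monk operators.

section Operators

variable {R : Type*} [CommRing R] (y : ℕ → R)

/-- The Monk operator of position `α`, with transpositions of positions below `N`. -/
def monkOp (N α : ℕ) (F : (ℕ → ℕ) → R) (w : ℕ → ℕ) : R :=
  y (w α) * F w + ∑ l ∈ range N, (coverSign w α l : R) * F (exch w α l)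

/-- Exchanges on disjoint pairs commute and cancel. The remaining index pairs are grouped by a third
position `c` as `(c, c)`, `(β, c)`, `(c, α)`. Their terms evaluate `F` at the two 3-cycles of `α, β,
c`, and one quadratic relation cancels the coefficient of each. -/
theorem monkOp_double_sum_comm {N α β : ℕ} (hα : α < N) (hβ : β < N) (hαβ : α ≠ β)
    (F : (ℕ → ℕ) → R) {w : ℕ → ℕ} (hw : w.Injective) :
    ∑ l ∈ range N, ∑ m ∈ range N, ((coverSign w α l * coverSign (exch w α l) β m : ℤ) : R)
        * F (exch (exch w α l) β m)
      = ∑ l ∈ range N, ∑ m ∈ range N, ((coverSign w β m * coverSign (exch w β m) α l : ℤ) : R)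
        * F (exch (exch w β m) α l) := by
  set D : ℕ → ℕ → R := fun l m =>
    ((coverSign w α l * coverSign (exch w α l) β m : ℤ) : R) * F (exch (exch w α l) β m)
    - ((coverSign w β m * coverSign (exch w β m) α l : ℤ) : R) * F (exch (exch w β m) α l) with hD
  have hαα : D α α = 0 := by simp [hD, coverSign_self]
  have hββ : D β β = 0 := by simp [hD, coverSign_self]
  have hβα : D β α = 0 := by
    simp only [hD]
    rw [coverSign_mul_reverse, coverSign_mul_reverse]
    simp
  have hl : ∀ m, D α m = 0 := by intro m; simp [hD, coverSign_self]
  have hm : ∀ l, D l β = 0 := by intro m; simp [hD, coverSign_self]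
  have hgen : ∀ l m, l ≠ β → m ≠ α → l ≠ m → D l m = 0 := by
    intro l m h1 h2 h3
    simp only [hD]
    rw [coverSign_mul_comm hw hαβ h2.symm h1 h3, exch_disjoint w hαβ h2.symm h1 h3, sub_self]
  have hthree : ∀ c, D c c + D β c + D c α = 0 := by
    intro c
    by_cases h1 : c = α
    · subst h1; simp [hαα, hβα]
    by_cases h2 : c = β
    · subst h2; simp [hββ, hβα]
    have e1 := coverSign_relation hw hαβ (Ne.symm h2) (Ne.symm h1)
    have e2 := coverSign_relation hw (Ne.symm h1) h2 hαβ
    have t1 := exch_triple w hαβ (Ne.symm h2) (Ne.symm h1)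
    have t2 := exch_triple w (Ne.symm h2) h1 hαβ.symm
    have t3 := exch_triple w (Ne.symm h1) h2 hαβ
    have t4 := exch_triple w h2 hαβ.symm h1
    simp only [hD]
    have f1 : exch (exch w α c) β c = exch (exch w α c) c β := exch_comm _ _ _
    have f2 : exch (exch w β c) α c = exch (exch w β c) c α := exch_comm _ _ _
    have f4 : exch (exch w β c) α β = exch (exch w α c) c β := by
      rw [t3, exch_comm w c β, exch_comm]
    have f5 : exch (exch w α c) β α = exch (exch w β c) c α := by
      rw [t2, exch_comm w c α, exch_comm]
    have f6 : exch (exch w β α) α c = exch (exch w α c) c β := by rw [t3, t4]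
    rw [f1, f2, t1, f4, f5, f6]
    rw [coverSign_swap w α c, exch_comm w c α, coverSign_swap (exch w α c) β α] at e1
    rw [coverSign_swap w β c, exch_comm w c β, coverSign_swap (exch w β c) α β,
      coverSign_swap (exch w α c) β c] at e2
    rw [coverSign_swap (exch w β c) c α]
    have e1' := congrArg (Int.cast : ℤ → R) e1
    have e2' := congrArg (Int.cast : ℤ → R) e2
    push_cast at e1' e2' ⊢
    linear_combination F (exch (exch w β c) c α) * e1' - F (exch (exch w α c) c β) * e2'
  -- `D` lives on the diagonal, the line `l = β` and the line `m = α`. These meet only at `(α, α)`,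
  -- `(β, β)` and `(β, α)`, where `D` vanishes, so nothing is counted twice.
  have hsplit : ∀ l m, D l m = (if l = m then D l l else 0) + (if l = β then D β m else 0)
      + (if m = α then D l α else 0) := by
    intro l m
    by_cases h1 : l = m <;> by_cases h2 : l = β <;> by_cases h3 : m = α <;> simp_all
  rw [← sub_eq_zero, ← sum_sub_distrib]
  simp_rw [← sum_sub_distrib]
  change ∑ l ∈ range N, ∑ m ∈ range N, D l m = 0
  calc ∑ l ∈ range N, ∑ m ∈ range N, D l m
      = ∑ c ∈ range N, (D c c + D β c + D c α) := by
        have hs : ∀ l ∈ range N, ∑ m ∈ range N, D l m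
            = D l l + (if l = β then ∑ m ∈ range N, D β m else 0) + D l α := by
          intro l hl
          rw [sum_congr rfl fun m _ => hsplit l m, sum_add_distrib, sum_add_distrib, sum_ite_eq,
            if_pos hl, sum_ite_eq', if_pos (mem_range.2 hα)]
          by_cases h : l = β <;> simp [h]
        rw [sum_congr rfl hs]
        simp only [sum_add_distrib, sum_ite_eq', mem_range, hβ, if_true]
    _ = 0 := sum_eq_zero fun c _ => hthree c

/-- In the terms with one exchange, only the exchange of `α` with `β` alters the letter whose `y` is
multiplied. The resulting correction is symmetric in `α` and `β`; the terms with two exchanges are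
`monkOp_double_sum_comm`. -/
theorem monkOp_comm {N α β : ℕ} (hα : α < N) (hβ : β < N) (F : (ℕ → ℕ) → R) {w : ℕ → ℕ}
    (hw : w.Injective) : monkOp y N α (monkOp y N β F) w = monkOp y N β (monkOp y N α F) w := by
  by_cases hαβ : α = β
  · rw [hαβ]
  have h1 : ∑ l ∈ range N, (coverSign w α l : R) * F (exch w α l) * (y (exch w α l β) - y (w β))
      = (coverSign w α β : R) * F (exch w α β) * (y (w α) - y (w β)) := by
    rw [sum_eq_single_of_mem β (mem_range.2 hβ)]
    · simp [exch_apply, Ne.symm hαβ]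
    · intro l _ hl
      rw [exch_apply, if_neg (Ne.symm hαβ), if_neg (Ne.symm hl), sub_self, mul_zero]
  have h2 : ∑ l ∈ range N, (coverSign w β l : R) * F (exch w β l) * (y (exch w β l α) - y (w α))
      = (coverSign w β α : R) * F (exch w β α) * (y (w β) - y (w α)) := by
    rw [sum_eq_single_of_mem α (mem_range.2 hα)]
    · simp [exch_apply, hαβ]
    · intro l _ hl
      rw [exch_apply, if_neg hαβ, if_neg (Ne.symm hl), sub_self, mul_zero]
  have h3 := monkOp_double_sum_comm hα hβ hαβ F hw
  rw [sum_comm (s := range N) (t := range N)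
    (f := fun l m => ((coverSign w β m * coverSign (exch w β m) α l : ℤ) : R)
        * F (exch (exch w β m) α l))] at h3
  rw [coverSign_swap w α β, exch_comm w β α] at h2
  simp only [mul_sub, sum_sub_distrib] at h1 h2
  simp only [← sum_mul] at h1 h2
  push_cast at h2 h3
  simp only [mul_assoc] at h3
  simp only [← mul_sum] at h3
  simp only [monkOp, mul_add, sum_add_distrib]
  have h4 : ∀ a b, ∑ l ∈ range N, (coverSign w a l : R) * (y (exch w a l b) * F (exch w a l))
    = ∑ l ∈ range N, (coverSign w a l : R) * F (exch w a l) * y (exch w a l b) :=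
    fun a b => sum_congr rfl fun l _ => by ring
  rw [h4, h4]
  linear_combination h1 - h2 + h3

end Operators

-- The row recursion and Monk's rule for words.

section Recursion

variable {R : Type*} [CommRing R]

open Classical in
/-- The weight sum of the row fillings to the left of column `c`, for a row entered from the south
in the columns `w 0, …, w (i - 1)` by pipes `0, …, i - 1`, where `z` is the weight of a blank tile
and `g` evaluates the columns in which the pipes leave the row to the north. -/
def rowPoly (z : ℕ → R) (i : ℕ) (g : (ℕ → ℕ) → R) (c : ℕ) (w : ℕ → ℕ) : R :=
  match c with
  | 0 => g w
  | c + 1 =>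
    -- The row is read from right to left, with no strand on the east edge of column `c`. A pipe
    -- arriving from the south must then go straight up.
    if ∃ k < i, w k = c then rowPoly z i g c w
    -- A free column holds a blank tile or a `j`-tile. In the second case pipe `k` turned east in
    -- column `w k`, crossed only smaller labels on the way, and now leaves north in column `c`; the
    -- columns from `w k` on are settled.
    else z c * rowPoly z i g c w + ∑ k ∈ range i,
      if _h : w k < c ∧ ∀ e, k < e → e < i → w e ≤ w k ∨ c ≤ w e then
        rowPoly z i g (w k) (Function.update w k c) else 0
termination_by c

/-- The double Schubert polynomial of the word `w 0, …, w (i - 1)`, row by row. -/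
def wordPoly (x y : ℕ → R) : ℕ → (ℕ → ℕ) → R
  | 0, _ => 1
  -- Pipe `i` turns east in column `w i`. To its right there are only horizontal strands and
  -- crosses, which have weight one.
  | i + 1, w => rowPoly (fun c => x i - y c) i (wordPoly x y i) (w i) w

theorem rowPoly_congr (z : ℕ → R) (i : ℕ) {g : (ℕ → ℕ) → R}
    (hg : ∀ w w' : ℕ → ℕ, (∀ k < i, w k = w' k) → g w = g w') (c : ℕ) :
    ∀ w w' : ℕ → ℕ, (∀ k < i, w k = w' k) → rowPoly z i g c w = rowPoly z i g c w' := by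
  induction c using Nat.strong_induction_on with
  | _ c ih =>
    intro w w' h
    cases c with
    | zero => rw [rowPoly, rowPoly]; exact hg w w' h
    | succ c =>
      rw [rowPoly, rowPoly, ih c (by omega) w w' h]
      have h1 : (∃ k < i, w k = c) ↔ ∃ k < i, w' k = c :=
        exists_congr fun k => and_congr_right fun hk => by rw [h k hk]
      simp only [h1]
      congr 2
      refine sum_congr rfl fun k hk => ?_
      have hk' := mem_range.1 hk
      have h2 : (w k < c ∧ ∀ e, k < e → e < i → w e ≤ w k ∨ c ≤ w e) ↔
          (w' k < c ∧ ∀ e, k < e → e < i → w' e ≤ w' k ∨ c ≤ w' e) := by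
        rw [h k hk']
        refine and_congr_right fun _ => forall_congr' fun e => forall_congr' fun _ =>
          forall_congr' fun he => by rw [h e he]
      by_cases h3 : w k < c ∧ ∀ e, k < e → e < i → w e ≤ w k ∨ c ≤ w e
      · rw [dif_pos h3, dif_pos (h2.1 h3), h k hk']
        refine ih (w' k) (by rw [← h k hk']; omega) _ _ fun e he => ?_
        simp only [Function.update_apply, h e he]
      · rw [dif_neg h3, dif_neg (fun h' => h3 (h2.2 h'))]

theorem wordPoly_congr (x y : ℕ → R) (i : ℕ) :
    ∀ w w' : ℕ → ℕ, (∀ k < i, w k = w' k) → wordPoly x y i w = wordPoly x y i w' := by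
  induction i with
  | zero => intro w w' _; rfl
  | succ i ih =>
    intro w w' h
    rw [wordPoly, wordPoly, h i (by omega)]
    exact rowPoly_congr _ i ih _ _ _ fun k _ => h k (by omega)

theorem rowPoly_eq_of_used (z : ℕ → R) (i : ℕ) (g : (ℕ → ℕ) → R) {w : ℕ → ℕ} {c d : ℕ}
    (hcd : c ≤ d) (h : ∀ e, c ≤ e → e < d → ∃ k < i, w k = e) :
    rowPoly z i g d w = rowPoly z i g c w := by
  induction d, hcd using Nat.le_induction with
  | base => rfl
  | succ d hd ih =>
    rw [rowPoly, if_pos (h d hd (by omega)), ih fun e h1 h2 => h e h1 (by omega)]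

/-- The letters of `w` increase from position `i` on. -/
def TailIncreasing (i : ℕ) (w : ℕ → ℕ) : Prop := ∀ a b, i ≤ a → a < b → w a < w b

/-- Every column left of `w i` is occupied by one of the pipes `0, …, i - 1`, so the row has no
blank tile and no pipe changes its column. -/
theorem wordPoly_succ_of_tailIncreasing (x y : ℕ → R) {i : ℕ} {w : ℕ → ℕ} (hw : w.Bijective)
    (h : TailIncreasing i w) : wordPoly x y (i + 1) w = wordPoly x y i w := by
  rw [wordPoly, rowPoly_eq_of_used _ i _ (Nat.zero_le _), rowPoly]
  intro e _ he
  obtain ⟨k, rfl⟩ := hw.2 e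
  refine ⟨k, ?_, rfl⟩
  by_contra hk
  rcases (not_lt.1 hk).eq_or_lt with rfl | h'
  · omega
  · have := h i k le_rfl h'
    omega

theorem wordPoly_of_tailIncreasing (x y : ℕ → R) {i n : ℕ} (hin : i ≤ n) {w : ℕ → ℕ}
    (hw : w.Bijective) (h : TailIncreasing i w) : wordPoly x y n w = wordPoly x y i w := by
  induction n, hin using Nat.le_induction with
  | base => rfl
  | succ n hn ih =>
    rw [wordPoly_succ_of_tailIncreasing x y hw fun a b ha hb => h a b (by omega) hb, ih]

/-- Once pipe `k` has moved from column `w k` to column `w i`, the part of the row still to be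
filled looks like that of the exchanged word, where pipe `i` turns in column `w k`. -/
theorem wordPoly_exch_lower (x y : ℕ → R) (i k : ℕ) (w : ℕ → ℕ) :
    wordPoly x y (i + 1) (exch w i k)
      = rowPoly (fun c => x i - y c) i (wordPoly x y i) (w k) (Function.update w k (w i)) := by
  rw [wordPoly, exch_apply, if_pos rfl]
  refine rowPoly_congr _ i (wordPoly_congr x y i) _ _ _ fun e he => ?_
  rw [exch_apply, Function.update_apply, if_neg (by omega)]

theorem lt_of_forall_ge_fixed {w : ℕ → ℕ} (hw : w.Injective) {B : ℕ} (hB : ∀ e, B ≤ e → w e = e)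
    {i : ℕ} (hi : i < B) : w i < B := by
  by_contra h
  have := hw (hB (w i) (by omega))
  omega

/-- Transition: Monk's rule at the last position before the increasing tail. -/
theorem monkOp_wordPoly_last (x y : ℕ → R) {i N B : ℕ} (hiB : i < B) (hBN : B < N) {w : ℕ → ℕ}
    (hw : w.Bijective) (h : TailIncreasing (i + 1) w) (hB : ∀ e, B ≤ e → w e = e) :
    monkOp y N i (wordPoly x y (i + 1)) w = x i * wordPoly x y (i + 1) w := by
  classical
  -- The first larger letter after `i` gives the only upward cover at `i`, since the tail increases.
  -- The fixed position `B` shows that it exists.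
  have hex : ∃ l, i < l ∧ w i < w l :=
    ⟨B, hiB, by rw [hB B le_rfl]; exact lt_of_forall_ge_fixed hw.1 hB hiB⟩
  set l := Nat.find hex with hl
  have hl1 : i < l := (Nat.find_spec hex).1
  have hl2 : w i < w l := (Nat.find_spec hex).2
  have hlmin : ∀ e, i < e → e < l → w e < w i := by
    intro e h1 h2
    have := Nat.find_min hex h2
    have := hw.1.ne (show e ≠ i by omega)
    grind
  have hlN : l < N := by
    have : l ≤ B := Nat.find_min' hex
      ⟨hiB, by rw [hB B le_rfl]; exact lt_of_forall_ge_fixed hw.1 hB hiB⟩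
    omega
  have hcov : IsCover w i l := ⟨hl1, hl2, fun e h1 h2 => Or.inl (hlmin e h1 h2).le⟩
  have hsign : ∀ e, coverSign w i e =
      (if e = l then 1 else 0) - (if e < i then if IsCover w e i then 1 else 0 else 0) := by
    intro e
    rcases lt_trichotomy e i with h1 | rfl | h1
    · rw [coverSign_swap w e i, coverSign_of_lt w h1]
      simp [h1, show e ≠ l by omega]
    · simp [coverSign_self, show e ≠ l by omega]
    · rw [coverSign_of_lt w h1, if_neg (show ¬ e < i by omega), sub_zero]
      congr 1
      refine propext ⟨fun hc => ?_, fun hc => hc ▸ hcov⟩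
      by_contra hne
      rcases lt_or_gt_of_ne hne with h2 | h2
      · have := hlmin e h1 h2
        have := hc.2.1
        omega
      · have h3 := hc.2.2 l hl1 h2
        have h4 := h l e (by omega) h2
        omega
  -- For `exch w i l`, row `i` is read from column `w l`. The columns strictly between `w i` and `w
  -- l` are occupied, while column `w i` has become free: a blank tile there gives the first
  -- summand, a `j`-tile the downward covers.
  have hupper : wordPoly x y (i + 1) (exch w i l)
      = (x i - y (w i)) * wordPoly x y (i + 1) w + ∑ k ∈ range i,
        if IsCover w k i then wordPoly x y (i + 1) (exch w i k) else 0 := by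
    rw [wordPoly, exch_apply, if_pos rfl, rowPoly_congr _ i (wordPoly_congr x y i) _ _ w,
      rowPoly_eq_of_used _ i _ (show w i + 1 ≤ w l by omega), rowPoly, if_neg, ← wordPoly]
    · congr 1
      refine sum_congr rfl fun k hk => ?_
      have hk' := mem_range.1 hk
      rw [wordPoly_exch_lower x y i k w]
      by_cases hc : IsCover w k i
      · rw [if_pos hc, dif_pos ⟨hc.2.1, hc.2.2⟩]
      · rw [if_neg hc, dif_neg fun h' => hc ⟨hk', h'.1, h'.2⟩]
    · rintro ⟨k, hk, hk'⟩
      have := hw.1 hk'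
      omega
    · intro e h1 h2
      obtain ⟨k, rfl⟩ := hw.2 e
      refine ⟨k, ?_, rfl⟩
      by_contra hk
      rcases lt_trichotomy k l with h3 | rfl | h3
      · rcases (not_lt.1 hk).eq_or_lt with h4 | h4
        · subst h4; omega
        · have := hlmin k h4 h3; omega
      · omega
      · have := h l k (by omega) h3
        omega
    · intro k hk
      rw [exch_apply, if_neg (by omega), if_neg (by omega)]
  have hsum : ∑ e ∈ range N, (coverSign w i e : R) * wordPoly x y (i + 1) (exch w i e)
      = wordPoly x y (i + 1) (exch w i l) - ∑ k ∈ range i,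
        if IsCover w k i then wordPoly x y (i + 1) (exch w i k) else 0 := by
    simp only [hsign]
    push_cast
    simp only [sub_mul, sum_sub_distrib, ite_mul, one_mul, zero_mul, sum_ite_eq', mem_range, hlN,
      if_true]
    congr 1
    rw [← sum_filter]
    refine sum_congr ?_ fun _ _ => rfl
    ext e
    simp only [mem_filter, mem_range]
    omega
  rw [monkOp, hsum, hupper]
  ring

theorem monkOp_congr (y : ℕ → R) (N α : ℕ) {F F' : (ℕ → ℕ) → R} {w : ℕ → ℕ} (h : F w = F' w)
    (h' : ∀ l < N, coverSign w α l ≠ 0 → F (exch w α l) = F' (exch w α l)) :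
    monkOp y N α F w = monkOp y N α F' w := by
  rw [monkOp, monkOp, h]
  congr 1
  refine sum_congr rfl fun l hl => ?_
  by_cases h0 : coverSign w α l = 0
  · simp [h0]
  · rw [h' l (mem_range.1 hl) h0]

theorem monkOp_mul (y : ℕ → R) (N α : ℕ) (r : R) (F : (ℕ → ℕ) → R) (w : ℕ → ℕ) :
    monkOp y N α (fun v => r * F v) w = r * monkOp y N α F w := by
  rw [monkOp, monkOp, mul_add, mul_sum]
  congr 1
  · ring
  · exact sum_congr rfl fun l _ => by ring

theorem coverSign_ne_zero {w : ℕ → ℕ} {a b : ℕ} (h : coverSign w a b ≠ 0) :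
    IsCover w a b ∨ IsCover w b a := by
  unfold coverSign at h
  by_contra h'
  rw [not_or] at h'
  simp [h'] at h

/-- If `b` lies in the tail, its letter drops to `w a`. The tail letters before `b` are smaller than
`w b`, hence by the cover condition also smaller than `w a`. -/
theorem IsCover.tailIncreasing_exch {i : ℕ} {w : ℕ → ℕ} {a b : ℕ} (hab : IsCover w a b)
    (ha : a < i) (hw : w.Injective) (h : TailIncreasing i w) : TailIncreasing i (exch w a b) := by
  intro c d hc hd
  have h1 := h c d hc hd
  have h2 := hab.2.1
  have h3 := hab.2.2
  have h4 := hab.1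
  simp only [exch_apply]
  have h5 := h3 c (by omega)
  have h6 : b < d → i ≤ b → w b < w d := fun h5 h6 => h b d h6 h5
  have h7 : c < b → w c < w b := fun h5 => h c b hc h5
  have h8 := hw.ne (show a ≠ c by omega)
  grind

/-- Monk's rule for words. -/
theorem monkOp_wordPoly (x y : ℕ → R) (n N : ℕ) (i : ℕ) (hi : i ≤ n) :
    ∀ B, i ≤ B → B + 1 < N → ∀ w : ℕ → ℕ, w.Bijective → TailIncreasing i w →
      (∀ e, B ≤ e → w e = e) → ∀ β < i,
        monkOp y N β (wordPoly x y n) w = x β * wordPoly x y n w := by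
  induction i with
  | zero => intro _ _ _ _ _ _ _ β hβ; omega
  | succ i IH =>
    intro B hiB hBN
    -- The bound `B'` is left free because the words one exchange away from `u` below may move
    -- position `B`.
    have last : ∀ B' < N, B ≤ B' → ∀ v : ℕ → ℕ, v.Bijective → TailIncreasing (i + 1) v →
        (∀ e, B' ≤ e → v e = e) →
        monkOp y N i (wordPoly x y n) v = x i * wordPoly x y n v := by
      intro B' hB' hBB' v hv hinc hfix
      rw [wordPoly_of_tailIncreasing x y hi hv hinc,
        ← monkOp_wordPoly_last x y (show i < B' by omega) hB' hv hinc hfix]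
      refine monkOp_congr y N i (wordPoly_of_tailIncreasing x y hi hv hinc) fun l _ h0 => ?_
      refine wordPoly_of_tailIncreasing x y hi (exch_bijective hv _ _) ?_
      rcases coverSign_ne_zero h0 with h1 | h1
      · exact h1.tailIncreasing_exch (by omega) hv.1 hinc
      · rw [exch_comm]
        exact h1.tailIncreasing_exch (by have := h1.1; omega) hv.1 hinc
    -- Inner induction on the letter at position `i`.
    suffices H : ∀ m, ∀ w : ℕ → ℕ, w i = m → w.Bijective → TailIncreasing (i + 1) w →
      (∀ e, B ≤ e → w e = e) → ∀ β < i + 1,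
        monkOp y N β (wordPoly x y n) w = x β * wordPoly x y n w from
      fun w => H (w i) w rfl
    intro m
    induction m using Nat.strong_induction_on with
    | _ m ih =>
      intro w hwm hw hinc hfix β hβ
      rcases (show β = i ∨ β < i by omega) with rfl | hβi
      · exact last B (by omega) le_rfl w hw hinc hfix
      by_cases hlow : ∃ l, i < l ∧ w l < w i
      · classical
        obtain ⟨l0, hl0, hl0'⟩ := hlow
        have hbound : ∀ l, w l < w i → l < B := by
          intro l hl
          by_contra hlB
          have := lt_of_forall_ge_fixed hw.1 hfix (show i < B by omega)
          rw [hfix l (by omega)] at hl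
          omega
        -- Taking the last smaller letter keeps the tail of `u = exch w i l` increasing and makes
        -- `l` its only upward cover at `i`.
        set l := Nat.findGreatest (fun l => i < l ∧ w l < w i) B with hldef
        have hl := Nat.findGreatest_spec (P := fun l => i < l ∧ w l < w i) (hbound l0 hl0').le
          ⟨hl0, hl0'⟩
        rw [← hldef] at hl
        obtain ⟨hil, hwl⟩ := hl
        have hmax : ∀ e, l < e → w i < w e := by
          intro e he
          by_contra hc
          have h1 := hw.1.ne (show e ≠ i by omega)
          have h2 : e ≤ B := (hbound e (by omega)).le
          have := Nat.le_findGreatest (P := fun l => i < l ∧ w l < w i) h2 ⟨by omega, by omega⟩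
          omega
        have hlB := hbound l hwl
        have hmid : ∀ e, i < e → e < l → w e < w l := fun e h1 h2 => hinc e l h1 h2
        set u := exch w i l with hu
        have huw : exch u i l = w := exch_exch w i l
        have hub : u.Bijective := exch_bijective hw i l
        have hui : u i = w l := by rw [hu, exch_apply, if_pos rfl]
        have hul : u l = w i := by rw [hu, exch_apply, if_neg (by omega), if_pos rfl]
        have hue : ∀ e, e ≠ i → e ≠ l → u e = w e := by
          intro e h1 h2; rw [hu, exch_apply, if_neg h1, if_neg h2]
        have huinc : TailIncreasing (i + 1) u := by
          intro a b ha hab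
          have h1 := hinc a b ha hab
          have h2 := hmid a
          have h3 := hmax b
          simp only [hu, exch_apply]
          grind
        have hufix : ∀ e, B ≤ e → u e = e := by
          intro e he; rw [hue e (by omega) (by omega), hfix e he]
        have hucov : IsCover u i l := by
          refine ⟨hil, by omega, fun e h1 h2 => Or.inl ?_⟩
          rw [hue e (by omega) (by omega), hui]
          exact (hmid e h1 h2).le
        have hcomm := monkOp_comm y (N := N) (α := β) (β := i) (by omega) (by omega)
          (wordPoly x y n) hub.1
        have hL : monkOp y N β (monkOp y N i (wordPoly x y n)) u
            = x i * monkOp y N β (wordPoly x y n) u := by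
          rw [← monkOp_mul]
          refine monkOp_congr y N β (last B (by omega) le_rfl u hub huinc hufix) fun e _ h0 => ?_
          refine last (B + 1) hBN (by omega) _ (exch_bijective hub _ _) ?_ ?_
          · rcases coverSign_ne_zero h0 with h1 | h1
            · exact h1.tailIncreasing_exch (by omega) hub.1 huinc
            · rw [exch_comm]
              exact h1.tailIncreasing_exch (by have := h1.1; omega) hub.1 huinc
          -- The fixed position `B` blocks covers from `β` to positions beyond `B`, so the new word
          -- is fixed from `B + 1` on.
          · have heB : e ≤ B := by
              by_contra hc
              rcases coverSign_ne_zero h0 with h1 | h1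
              · have h2 := h1.2.2 B (by omega) (by omega)
                have h3 := lt_of_forall_ge_fixed hub.1 hufix (show β < B by omega)
                rw [hufix B le_rfl, hufix e (by omega)] at h2
                omega
              · have := h1.1
                omega
            intro f hf
            rw [exch_apply, if_neg (by omega), if_neg (by omega), hufix f (by omega)]
        have ihu : ∀ v : ℕ → ℕ, v i < w i → v.Bijective → TailIncreasing (i + 1) v →
            (∀ e, B ≤ e → v e = e) →
            monkOp y N β (wordPoly x y n) v = x β * wordPoly x y n v :=
          fun v h1 h2 h3 h4 => ih (v i) (by omega) v rfl h2 h3 h4 β hβ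
        have hβu := ihu u (by omega) hub huinc hufix
        have hiu := last B (by omega) le_rfl u hub huinc hufix
        rw [hL, hβu] at hcomm
        have hone : coverSign u i l = 1 := by rw [coverSign_of_lt u hil, if_pos hucov]
        have hR : ∀ F : (ℕ → ℕ) → R, monkOp y N i F u = y (u i) * F u + (F w
            + ∑ e ∈ (range N).erase l, (coverSign u i e : R) * F (exch u i e)) := by
          intro F
          rw [monkOp, ← add_sum_erase _ _ (mem_range.2 (show l < N by omega)), hone, huw]
          simp
        have hS : ∑ e ∈ (range N).erase l, (coverSign u i e : R)
              * monkOp y N β (wordPoly x y n) (exch u i e)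
            = x β * ∑ e ∈ (range N).erase l, (coverSign u i e : R)
              * wordPoly x y n (exch u i e) := by
          rw [mul_sum]
          refine sum_congr rfl fun e he => ?_
          by_cases h0 : coverSign u i e = 0
          · simp [h0]
          rw [ihu (exch u i e)]
          · ring
          all_goals
            -- All other terms of operator `i` at `u` come from covers on its left, so they put a
            -- letter below `u i < w i` at position `i` and the inner induction applies.
            have hcov' : IsCover u e i := by
              rcases coverSign_ne_zero h0 with h1 | h1
              · exfalso
                have hel := (mem_erase.1 he).1
                rcases lt_or_gt_of_ne hel with h2 | h2
                · have := hmid e h1.1 h2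
                  have := h1.2.1
                  rw [hui, hue e (by have := h1.1; omega) hel] at this
                  omega
                · have h3 := h1.2.2 l hil h2
                  have := hmax e h2
                  rw [hui, hul, hue e (by have := h1.1; omega) hel] at h3
                  omega
              · exact h1
          · rw [exch_apply, if_pos rfl]
            have := hcov'.2.1
            omega
          · exact exch_bijective hub _ _
          · rw [exch_comm]
            exact hcov'.tailIncreasing_exch (by have := hcov'.1; omega) hub.1 huinc
          · intro f hf
            have := hcov'.1
            rw [exch_apply, if_neg (by omega), if_neg (by omega), hufix f hf]
        rw [hR, hS, hβu] at hcomm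
        rw [hR] at hiu
        linear_combination -x β * hiu - hcomm
      · refine IH (by omega) B (by omega) hBN w hw ?_ hfix β hβi
        intro a b ha hab
        rcases ha.eq_or_lt with rfl | ha
        · have := hw.1.ne (show i ≠ b by omega)
          by_contra hc
          exact hlow ⟨b, hab, by omega⟩
        · exact hinc a b ha hab

end Recursion

-- Bruhat covers given by transpositions.

section Bruhat

variable {n : ℕ}

/-- Reindexing the pairs by the transposition leaves the condition on letters equal to that of `π`,
so that only the position orders differ. -/
theorem permLength_mul_swap (π : Equiv.Perm (Fin n)) (a b : Fin n) :
    permLength (π * Equiv.swap a b) = (univ.filter fun p : Fin n × Fin n =>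
      Equiv.swap a b p.1 < Equiv.swap a b p.2 ∧ π p.2 < π p.1).card := by
  unfold permLength
  refine card_equiv ((Equiv.swap a b).prodCongr (Equiv.swap a b)) fun p => ?_
  rw [mem_filter, mem_filter]
  simp

/-- Matches the inversions of `π` with inversions of `π * swap a b`. -/
def inversionMap (a b : Fin n) (p : Fin n × Fin n) : Fin n × Fin n :=
  if p.1 = a ∧ p.2 < b then (b, p.2) else if p.2 = b ∧ a < p.1 then (p.1, a) else p

/-- An inversion of `a` or `b` with a position between them loses its position order; moving it to
the other of `a`, `b` repairs this, and `π a < π b` preserves the order of letters. The new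
inversion `(b, a)` is missed. -/
theorem image_inversionMap_subset (π : Equiv.Perm (Fin n)) {a b : Fin n} (hab : a < b)
    (h : π a < π b) :
    ((univ.filter fun p : Fin n × Fin n => p.1 < p.2 ∧ π p.2 < π p.1).image (inversionMap a b))
      ⊆ (univ.filter fun p : Fin n × Fin n =>
      Equiv.swap a b p.1 < Equiv.swap a b p.2 ∧ π p.2 < π p.1).erase (b, a) := by
  intro q hq
  simp only [mem_image, mem_filter, mem_univ, true_and, Prod.exists] at hq
  obtain ⟨c, d, ⟨h1, h2⟩, rfl⟩ := hq
  rw [mem_erase, mem_filter]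
  simp only [mem_univ, true_and, inversionMap, Equiv.swap_apply_def, ne_eq]
  grind

theorem inversionMap_injOn (π : Equiv.Perm (Fin n)) (a b : Fin n) :
    Set.InjOn (inversionMap a b)
      (univ.filter fun p : Fin n × Fin n => p.1 < p.2 ∧ π p.2 < π p.1) := by
  rintro ⟨c, d⟩ h1 ⟨c', d'⟩ h2 h3
  simp only [coe_filter, mem_univ, true_and, Set.mem_ofPred_eq] at h1 h2
  simp only [inversionMap] at h3
  grind

theorem permLength_lt_mul_swap (π : Equiv.Perm (Fin n)) {a b : Fin n} (hab : a < b)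
    (h : π a < π b) : permLength π < permLength (π * Equiv.swap a b) := by
  rw [permLength_mul_swap]
  have h1 := card_le_card (image_inversionMap_subset π hab h)
  rw [card_image_of_injOn (inversionMap_injOn π a b), card_erase_of_mem] at h1
  · have : 0 < (univ.filter fun p : Fin n × Fin n =>
      Equiv.swap a b p.1 < Equiv.swap a b p.2 ∧ π p.2 < π p.1).card := by
      refine card_pos.2 ⟨(b, a), ?_⟩
      simp [h, hab]
    unfold permLength
    omega
  · simp [h, hab]

/-- Without an intermediate letter, `inversionMap` reaches every new inversion except `(b, a)`. -/
theorem permLength_mul_swap_le (π : Equiv.Perm (Fin n)) {a b : Fin n} (hab : a < b)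
    (hno : ∀ e, a < e → e < b → π e ≤ π a ∨ π b ≤ π e) :
    permLength (π * Equiv.swap a b) ≤ permLength π + 1 := by
  rw [permLength_mul_swap]
  unfold permLength
  rw [← card_image_of_injOn (inversionMap_injOn π a b)]
  refine (card_le_card ?_).trans (card_insert_le (b, a) _)
  rintro ⟨c, d⟩ hq
  simp only [mem_filter, mem_univ, true_and] at hq
  simp only [mem_insert, mem_image, mem_filter, mem_univ, true_and, Prod.exists]
  by_cases h0 : (c, d) = (b, a)
  · exact Or.inl h0
  right
  have hne : ∀ e, e ≠ a → π e ≠ π a := fun e he => π.injective.ne he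
  have hne' : ∀ e, e ≠ b → π e ≠ π b := fun e he => π.injective.ne he
  by_cases h1 : c = b ∧ a < d ∧ d < b
  · refine ⟨a, d, ?_, ?_⟩
    · have := hno d
      grind
    · simp [inversionMap, h1]
  by_cases h2 : d = a ∧ a < c ∧ c < b
  · refine ⟨c, b, ?_, ?_⟩
    · have := hno c
      grind
    · simp only [inversionMap]
      grind
  refine ⟨c, d, ?_, ?_⟩
  · simp only [Equiv.swap_apply_def] at hq
    grind
  · simp only [inversionMap]
    simp only [Equiv.swap_apply_def] at hq
    grind

theorem permLength_lt_of_bruhatLT {π σ : Equiv.Perm (Fin n)} (h : BruhatLT π σ) :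
    permLength π < permLength σ := by
  induction h with
  | single h => obtain ⟨_, _, _, _, h⟩ := h; exact h
  | tail _ h ih => obtain ⟨_, _, _, _, h⟩ := h; exact ih.trans h

theorem bruhatStep_mul_swap (π : Equiv.Perm (Fin n)) {a b : Fin n} (hab : a < b)
    (h : π a < π b) : BruhatStep π (π * Equiv.swap a b) :=
  ⟨a, b, hab.ne, rfl, permLength_lt_mul_swap π hab h⟩

/-- The permutation `π` as a word, extended by fixed points. -/
def permWord (π : Equiv.Perm (Fin n)) (e : ℕ) : ℕ := if h : e < n then π ⟨e, h⟩ else e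

theorem permWord_fin (π : Equiv.Perm (Fin n)) (e : Fin n) : permWord π e = π e := by
  simp [permWord]

theorem permWord_of_le (π : Equiv.Perm (Fin n)) {e : ℕ} (h : n ≤ e) : permWord π e = e := by
  simp [permWord, not_lt.2 h]

theorem permWord_bijective (π : Equiv.Perm (Fin n)) : (permWord π).Bijective := by
  refine Function.bijective_iff_has_inverse.2 ⟨permWord π⁻¹, fun e => ?_, fun e => ?_⟩ <;>
  · by_cases h : e < n
    · lift e to Fin n using h
      rw [permWord_fin, permWord_fin]
      simp
    · rw [permWord_of_le _ (not_lt.1 h), permWord_of_le _ (not_lt.1 h)]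

theorem permWord_mul_swap (π : Equiv.Perm (Fin n)) (a b : Fin n) :
    permWord (π * Equiv.swap a b) = exch (permWord π) a b := by
  funext e
  rw [exch_apply]
  by_cases h : e < n
  · lift e to Fin n using h
    simp only [permWord_fin, Equiv.Perm.mul_apply, Equiv.swap_apply_def, Fin.val_inj]
    split_ifs <;> rfl
  · rw [if_neg (by omega), if_neg (by omega), permWord_of_le _ (not_lt.1 h),
      permWord_of_le _ (not_lt.1 h)]

theorem isCover_permWord (π : Equiv.Perm (Fin n)) {a b : Fin n} :
    IsCover (permWord π) a b ↔
      a < b ∧ π a < π b ∧ ∀ e, a < e → e < b → π e ≤ π a ∨ π b ≤ π e := by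
  simp only [IsCover, permWord_fin, Fin.val_fin_lt]
  refine and_congr_right fun hab => and_congr_right fun h => ⟨fun h e h1 h2 => ?_,
    fun h e h1 h2 => ?_⟩
  · have := h e h1 h2
    rwa [permWord_fin] at this
  · have he : e < n := by omega
    lift e to Fin n using he
    rw [permWord_fin]
    exact h e h1 h2

theorem bruhatCovers_mul_swap_iff (π : Equiv.Perm (Fin n)) {a b : Fin n} (hab : a < b) :
    BruhatCovers (π * Equiv.swap a b) π ↔ IsCover (permWord π) a b := by
  rw [isCover_permWord]
  constructor
  · rintro ⟨h1, h2⟩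
    have hlt : π a < π b := by
      by_contra hc
      have hne := π.injective.ne hab.ne
      have h3 := permLength_lt_mul_swap (π * Equiv.swap a b) hab (by simp; grind)
      have h4 := permLength_lt_of_bruhatLT h1
      rw [mul_assoc, Equiv.swap_mul_self, mul_one] at h3
      omega
    refine ⟨hab, hlt, fun e hae heb => ?_⟩
    by_contra hc
    rw [not_or, not_le, not_le] at hc
    have e1 : e ≠ a := hae.ne'
    have e2 : e ≠ b := heb.ne
    have e3 : a ≠ b := hab.ne
    -- An intermediate letter at `e` splits the exchange of `a` and `b` into three lengthening
    -- exchanges, since `t_{a,e} t_{a,b} t_{e,b} = t_{a,b}`.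
    refine h2 (π * Equiv.swap a e) ⟨.single (bruhatStep_mul_swap π hae hc.1), ?_⟩
    have s1 := bruhatStep_mul_swap (π * Equiv.swap a e) hab (by
      simp [Equiv.swap_apply_of_ne_of_ne e3.symm e2.symm, hc.2])
    have s2 := bruhatStep_mul_swap (π * Equiv.swap a e * Equiv.swap a b) heb (by
      simp [Equiv.swap_apply_of_ne_of_ne e1 e2, hc.1])
    have : π * Equiv.swap a e * Equiv.swap a b * Equiv.swap e b = π * Equiv.swap a b := by
      ext x
      simp only [Equiv.Perm.mul_apply, Equiv.swap_apply_def]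
      congr 2
      grind
    rw [this] at s2
    exact (Relation.TransGen.single s1).tail s2
  · rintro ⟨-, hlt, hno⟩
    refine ⟨.single (bruhatStep_mul_swap π hab hlt), fun τ ⟨h1, h2⟩ => ?_⟩
    have h3 := permLength_lt_of_bruhatLT h1
    have h4 := permLength_lt_of_bruhatLT h2
    have h5 := permLength_mul_swap_le π hab hno
    omega

end Bruhat

-- Sums of signed monomials determine multiplicities.

section Weights

variable {n : ℕ}

/-- A monomial in the `x_i` and the `-y_j`. -/
def signedMonomial (e : Fin n ⊕ Fin n →₀ ℕ) : XYPoly n :=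
  MvPolynomial.monomial e ((-1) ^ ∑ j, e (Sum.inr j))

theorem signedMonomial_mul (e e' : Fin n ⊕ Fin n →₀ ℕ) :
    signedMonomial e * signedMonomial e' = signedMonomial (e + e') := by
  simp [signedMonomial, MvPolynomial.monomial_mul, sum_add_distrib, pow_add]

/-- The products of variables `x_i` and of `-y_j`. -/
def signedMonomials (n : ℕ) : Submonoid (XYPoly n) where
  carrier := Set.range signedMonomial
  one_mem' := ⟨0, by simp [signedMonomial]⟩
  mul_mem' := by
    rintro _ _ ⟨e, rfl⟩ ⟨e', rfl⟩
    exact ⟨_, (signedMonomial_mul e e').symm⟩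

theorem blankLabel_factor_mem (i j : Fin n) (b : BlankLabel) :
    b.factor i j ∈ signedMonomials n := by
  cases b with
  | x => exact ⟨Finsupp.single (Sum.inl i) 1, by
      simp [signedMonomial, BlankLabel.factor, xVar, MvPolynomial.X]⟩
  | negY => exact ⟨Finsupp.single (Sum.inr j) 1, by
      simp [signedMonomial, BlankLabel.factor, yVar, MvPolynomial.X, Finsupp.single_apply]⟩

theorem mon_mem {π : Equiv.Perm (Fin n)} (E : DecoratedBPD π) : E.mon ∈ signedMonomials n :=
  Submonoid.prod_mem _ fun _ _ => blankLabel_factor_mem _ _ _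

-- All summands with exponent `m` carry the same sign, so the coefficient counts them up to that
-- sign.
open Classical in
theorem coeff_sum_signedMonomial {C : Type*} [Fintype C] (d : C → (Fin n ⊕ Fin n →₀ ℕ))
    (m : Fin n ⊕ Fin n →₀ ℕ) : MvPolynomial.coeff m (∑ c, signedMonomial (d c))
      = (-1) ^ (∑ j, m (Sum.inr j)) * (Fintype.card {c // d c = m} : ℤ) := by
  rw [MvPolynomial.coeff_sum, Fintype.card_subtype, card_filter]
  push_cast
  rw [mul_sum]
  refine sum_congr rfl fun c _ => ?_
  rw [signedMonomial, MvPolynomial.coeff_monomial]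
  split_ifs with hc
  · rw [hc]; simp
  · simp

/-- Two finite families of signed monomials with the same sum are equal up to a bijection of their
index types. -/
theorem exists_equiv_of_sum_eq {A B : Type*} [Fintype A] [Fintype B] (f : A → XYPoly n)
    (g : B → XYPoly n) (hf : ∀ a, f a ∈ signedMonomials n) (hg : ∀ b, g b ∈ signedMonomials n)
    (h : ∑ a, f a = ∑ b, g b) : ∃ Φ : A ≃ B, ∀ a, g (Φ a) = f a := by
  classical
  choose e he using hf
  choose e' he' using hg
  have hcard : ∀ m, Nonempty ({a // e a = m} ≃ {b // e' b = m}) := by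
    intro m
    rw [← Fintype.card_eq]
    have h1 := congrArg (MvPolynomial.coeff m) h
    simp only [← he, ← he'] at h1
    rw [coeff_sum_signedMonomial, coeff_sum_signedMonomial] at h1
    exact_mod_cast mul_left_cancel₀ (pow_ne_zero _ (by norm_num)) h1
  have E := fun m => (hcard m).some
  refine ⟨(Equiv.sigmaFiberEquiv e).symm.trans ((Equiv.sigmaCongrRight E).trans
    (Equiv.sigmaFiberEquiv e')), fun a => ?_⟩
  rw [← he a, ← he']
  congr 1
  exact (E (e a) ⟨a, rfl⟩).2

end Weights

-- Labels of pipes and weight sums of rows.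

section Labels

/-- The label of the pipe at the north edge of a tile, given the labels at its south and west
edges. -/
def northLabel : Tile → Option ℕ → Option ℕ → Option ℕ
  | .r, _, _ => none | .j, _, w => w | .cross, s, _ => s
  | .blank, _, _ => none | .horiz, _, _ => none | .vert, s, _ => s

/-- The label of the pipe at the east edge of a tile, given the labels at its south and west
edges. -/
def eastLabel : Tile → Option ℕ → Option ℕ → Option ℕ
  | .r, s, _ => s | .j, _, _ => none | .cross, _, w => w
  | .blank, _, _ => none | .horiz, _, w => w | .vert, _, _ => none

/-- The label at the west edge of the tile in column `c` of the row `ρ`, entered from the south by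
the labels `s`. -/
def rowWest (ρ : ℕ → Tile) (s : ℕ → Option ℕ) : ℕ → Option ℕ
  | 0 => none
  | c + 1 => eastLabel (ρ c) (s c) (rowWest ρ s c)

/-- The label at the north edge of the tile in column `c`. -/
def rowNorth (ρ : ℕ → Tile) (s : ℕ → Option ℕ) (c : ℕ) : Option ℕ :=
  northLabel (ρ c) (s c) (rowWest ρ s c)

/-- The tile has strands exactly where pipes arrive, and in a crossing the horizontal pipe has the
larger label. -/
def TileFits (τ : Tile) (s w : Option ℕ) : Prop :=
  s.isSome = τ.south ∧ w.isSome = τ.west ∧ (τ = .cross → ∀ p ∈ w, ∀ q ∈ s, q < p)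

theorem eastLabel_eq_some {τ : Tile} {s w : Option ℕ} {k : ℕ} (h : eastLabel τ s w = some k) :
    s = some k ∨ w = some k := by
  cases τ <;> simp_all [eastLabel]

theorem northLabel_eq_some {τ : Tile} {s w : Option ℕ} {k : ℕ} (h : northLabel τ s w = some k) :
    s = some k ∨ w = some k := by
  cases τ <;> simp_all [northLabel]

theorem rowWest_eq_some {ρ : ℕ → Tile} {s : ℕ → Option ℕ} {c k : ℕ}
    (h : rowWest ρ s c = some k) : ∃ a < c, s a = some k := by
  induction c with
  | zero => simp [rowWest] at h
  | succ c ih =>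
    rcases eastLabel_eq_some h with h | h
    · exact ⟨c, by omega, h⟩
    · obtain ⟨a, ha, h⟩ := ih h
      exact ⟨a, by omega, h⟩

theorem rowWest_congr {ρ ρ' : ℕ → Tile} {c : ℕ} (h : ∀ a < c, ρ a = ρ' a) (s : ℕ → Option ℕ) :
    rowWest ρ s c = rowWest ρ' s c := by
  induction c with
  | zero => rfl
  | succ c ih => rw [rowWest, rowWest, h c (by omega), ih fun a ha => h a (by omega)]

theorem rowNorth_congr {ρ ρ' : ℕ → Tile} {c : ℕ} (h : ∀ a ≤ c, ρ a = ρ' a) (s : ℕ → Option ℕ) :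
    rowNorth ρ s c = rowNorth ρ' s c := by
  rw [rowNorth, rowNorth, h c le_rfl, rowWest_congr fun a ha => h a ha.le]

end Labels

/-- A finite sequence, continued by a default value. -/
def extend {A : Type*} (d : A) {c : ℕ} (f : Fin c → A) (a : ℕ) : A :=
  if h : a < c then f ⟨a, h⟩ else d

theorem extend_fin {A : Type*} (d : A) {c : ℕ} (f : Fin c → A) (a : Fin c) :
    extend d f a = f a := by
  simp [extend]

theorem extend_of_le {A : Type*} (d : A) {c : ℕ} (f : Fin c → A) {a : ℕ} (h : c ≤ a) :
    extend d f a = d := by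
  simp [extend, not_lt.2 h]

theorem extend_snoc_of_lt {A : Type*} (d : A) {c : ℕ} (f : Fin c → A) (v : A) {a : ℕ}
    (ha : a < c) : extend d (Fin.snoc f v : Fin (c + 1) → A) a = extend d f a := by
  simp [extend, ha, Nat.lt_succ_of_lt ha, Fin.snoc]

theorem extend_snoc_self {A : Type*} (d : A) {c : ℕ} (f : Fin c → A) (v : A) :
    extend d (Fin.snoc f v : Fin (c + 1) → A) c = v := by
  simp [extend, Fin.snoc]

theorem sum_fin_succ_fun {A R : Type*} [Fintype A] [AddCommMonoid R] {c : ℕ}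
    (F : (Fin (c + 1) → A) → R) :
    ∑ f, F f = ∑ v : A, ∑ f : Fin c → A, F (Fin.snoc f v) := by
  rw [← Fintype.sum_prod_type', ← (Fin.snocEquiv fun _ => A).sum_comp]
  rfl

section RowSum

variable {R : Type*} [CommRing R]

open Classical in
/-- The weight sum of the fillings of the columns below `c` of a row entered from the south by the
labels `s` and left to the east by the label `h`, where `g` evaluates the labels leaving to the
north, which are continued by `t`. -/
def rowSum (z : ℕ → R) (g : (ℕ → Option ℕ) → R) (s : ℕ → Option ℕ) (c : ℕ) (h : Option ℕ)
    (t : ℕ → Option ℕ) : R :=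
  ∑ ρ : Fin c → Tile,
    if (∀ a < c, TileFits (extend .blank ρ a) (s a) (rowWest (extend .blank ρ) s a)) ∧
        rowWest (extend .blank ρ) s c = h then
      (∏ a ∈ range c, if extend .blank ρ a = .blank then z a else 1) *
        g fun a => if a < c then rowNorth (extend .blank ρ) s a else t a
    else 0

variable (z : ℕ → R) (g : (ℕ → Option ℕ) → R) (s : ℕ → Option ℕ)

theorem rowSum_congr (c : ℕ) (h : Option ℕ) {t t' : ℕ → Option ℕ}
    (ht : ∀ a, c ≤ a → t a = t' a) : rowSum z g s c h t = rowSum z g s c h t' := by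
  unfold rowSum
  have : ∀ n : ℕ → Option ℕ, (fun a => if a < c then n a else t a)
      = fun a => if a < c then n a else t' a := by
    intro n
    funext a
    split_ifs with h
    · rfl
    · exact ht a (by omega)
  simp only [this]

theorem rowSum_zero (t : ℕ → Option ℕ) : rowSum z g s 0 none t = g t := by
  simp [rowSum, rowWest]

theorem rowSum_eq_zero (c k : ℕ) (t : ℕ → Option ℕ) (h : ∀ a < c, s a ≠ some k) :
    rowSum z g s c (some k) t = 0 := by
  refine sum_eq_zero fun ρ _ => if_neg fun ⟨_, h'⟩ => ?_
  obtain ⟨a, ha, h''⟩ := rowWest_eq_some h'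
  exact h a ha h''

-- Splits off the rightmost tile and sums over the label on its west edge; `K` keeps the set of
-- possible labels finite. The label going north is recorded in `t`.
open Classical in
theorem rowSum_succ {K : ℕ} (c : ℕ) (h : Option ℕ) (t : ℕ → Option ℕ)
    (hK : ∀ a < c, ∀ q ∈ s a, q < K) :
    rowSum z g s (c + 1) h t = ∑ τ : Tile, ∑ w ∈ insertNone (range K),
      if TileFits τ (s c) w ∧ eastLabel τ (s c) w = h then
        (if τ = .blank then z c else 1)
          * rowSum z g s c w (Function.update t c (northLabel τ (s c) w))
      else 0 := by
  rw [rowSum, sum_fin_succ_fun]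
  refine sum_congr rfl fun τ _ => ?_
  simp only [rowSum, mul_sum]
  have hW : ∀ ρ : Fin c → Tile, rowWest (extend .blank ρ) s c ∈ insertNone (range K) := by
    intro ρ
    rw [mem_insertNone]
    intro k hk
    obtain ⟨a, ha, h'⟩ := rowWest_eq_some hk
    exact mem_range.2 (hK a ha k h')
  have hpull : ∀ w, (if TileFits τ (s c) w ∧ eastLabel τ (s c) w = h then
      ∑ ρ : Fin c → Tile, (if τ = .blank then z c else 1) *
        (if (∀ a < c, TileFits (extend .blank ρ a) (s a) (rowWest (extend .blank ρ) s a)) ∧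
          rowWest (extend .blank ρ) s c = w then
        (∏ a ∈ range c, if extend .blank ρ a = .blank then z a else 1) *
          g fun a => if a < c then rowNorth (extend .blank ρ) s a
            else Function.update t c (northLabel τ (s c) w) a
        else 0) else 0) = ∑ ρ : Fin c → Tile,
          if rowWest (extend .blank ρ) s c = w then
            (if (∀ a < c, TileFits (extend .blank ρ a) (s a) (rowWest (extend .blank ρ) s a)) ∧
              TileFits τ (s c) w ∧ eastLabel τ (s c) w = h then
            (if τ = .blank then z c else 1) *
            ((∏ a ∈ range c, if extend .blank ρ a = .blank then z a else 1) *
            g fun a => if a < c then rowNorth (extend .blank ρ) s a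
            else Function.update t c (northLabel τ (s c) w) a) else 0) else 0 := by
    intro w
    by_cases h1 : TileFits τ (s c) w ∧ eastLabel τ (s c) w = h
    · rw [if_pos h1]
      refine sum_congr rfl fun ρ _ => ?_
      by_cases h2 : rowWest (extend .blank ρ) s c = w <;> simp [h1, h2]
    · simp only [h1, and_false, if_false, ite_self, sum_const_zero]
  simp only [hpull]
  rw [sum_comm]
  refine sum_congr rfl fun ρ _ => ?_
  rw [sum_ite_eq, if_pos (hW ρ)]
  have e1 : ∀ a < c, extend Tile.blank (Fin.snoc ρ τ : Fin (c + 1) → Tile) a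
      = extend .blank ρ a := fun a ha => extend_snoc_of_lt _ _ _ ha
  have e2 : extend Tile.blank (Fin.snoc ρ τ : Fin (c + 1) → Tile) c = τ := extend_snoc_self _ _ _
  have e3 : ∀ a ≤ c, rowWest (extend Tile.blank (Fin.snoc ρ τ : Fin (c + 1) → Tile)) s a
      = rowWest (extend .blank ρ) s a :=
    fun a ha => rowWest_congr (fun b hb => e1 b (by omega)) s
  have e4 : (fun a => if a < c + 1 then
        rowNorth (extend Tile.blank (Fin.snoc ρ τ : Fin (c + 1) → Tile)) s a else t a)
      = fun a => if a < c then rowNorth (extend .blank ρ) s a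
          else Function.update t c (northLabel τ (s c) (rowWest (extend .blank ρ) s c)) a := by
    funext a
    rcases lt_trichotomy a c with h1 | rfl | h1
    · rw [if_pos (by omega), if_pos h1]
      exact rowNorth_congr (fun b hb => e1 b (by omega)) s
    · rw [if_pos (by omega), if_neg (lt_irrefl _), Function.update_self, rowNorth, e2, e3 _ le_rfl]
    · rw [if_neg (by omega), if_neg (by omega), Function.update_of_ne (by omega)]
  rw [e4]
  have e5 : (∀ a < c + 1, TileFits (extend Tile.blank (Fin.snoc ρ τ : Fin (c + 1) → Tile) a) (s a)
        (rowWest (extend Tile.blank (Fin.snoc ρ τ : Fin (c + 1) → Tile)) s a)) ↔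
      (∀ a < c, TileFits (extend .blank ρ a) (s a) (rowWest (extend .blank ρ) s a)) ∧
        TileFits τ (s c) (rowWest (extend .blank ρ) s c) := by
    rw [Nat.forall_lt_succ_right, e2, e3 c le_rfl]
    refine and_congr_left fun _ => forall_congr' fun a => forall_congr' fun ha => ?_
    rw [e1 a ha, e3 a ha.le]
  refine if_congr (by rw [e5, rowWest, e2, e3 c le_rfl, and_assoc]) ?_ rfl
  rw [prod_range_succ, e2, prod_congr rfl fun a ha => by rw [e1 a (mem_range.1 ha)]]
  ring

theorem tile_univ : (univ : Finset Tile) = {.r, .j, .cross, .blank, .horiz, .vert} := rfl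

/-- The labels at the south and east edges nearly determine the tile: a vertical strand here, and in
the next four lemmas a blank or `j`-tile, an `r`-tile, a horizontal strand, and a cross. -/
theorem rowSum_succ_none_some {K q : ℕ} (c : ℕ) (t : ℕ → Option ℕ)
    (hK : ∀ a < c, ∀ q ∈ s a, q < K) (hc : s c = some q) :
    rowSum z g s (c + 1) none t = rowSum z g s c none (Function.update t c (some q)) := by
  rw [rowSum_succ z g s c none t hK, tile_univ]
  simp [TileFits, hc, Tile.south, Tile.west, eastLabel, northLabel, sum_insertNone]

theorem rowSum_succ_none_none {K : ℕ} (c : ℕ) (t : ℕ → Option ℕ)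
    (hK : ∀ a < c, ∀ q ∈ s a, q < K) (hc : s c = none) :
    rowSum z g s (c + 1) none t = z c * rowSum z g s c none (Function.update t c none)
      + ∑ k ∈ range K, rowSum z g s c (some k) (Function.update t c (some k)) := by
  rw [rowSum_succ z g s c none t hK, tile_univ]
  simp [TileFits, hc, Tile.south, Tile.west, eastLabel, northLabel, sum_insertNone]
  ring

theorem rowSum_succ_some_self {K k : ℕ} (c : ℕ) (t : ℕ → Option ℕ)
    (hK : ∀ a < c, ∀ q ∈ s a, q < K) (hc : s c = some k) :
    rowSum z g s (c + 1) (some k) t = rowSum z g s c none (Function.update t c none) := by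
  rw [rowSum_succ z g s c _ t hK, tile_univ]
  simp [TileFits, hc, Tile.south, Tile.west, eastLabel, northLabel, sum_insertNone]
  -- A cross would make pipe `k` cross itself, against the strict inequality in `TileFits`.
  exact sum_eq_zero fun x _ => if_neg (by omega)

theorem rowSum_succ_some_none {K k : ℕ} (c : ℕ) (t : ℕ → Option ℕ)
    (hK : ∀ a < c, ∀ q ∈ s a, q < K) (hc : s c = none) (hk : k < K) :
    rowSum z g s (c + 1) (some k) t = rowSum z g s c (some k) (Function.update t c none) := by
  rw [rowSum_succ z g s c _ t hK, tile_univ]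
  simp [TileFits, hc, Tile.south, Tile.west, eastLabel, northLabel, sum_insertNone]
  omega

theorem rowSum_succ_some_some {K k q : ℕ} (c : ℕ) (t : ℕ → Option ℕ)
    (hK : ∀ a < c, ∀ q ∈ s a, q < K) (hc : s c = some q) (hqk : q ≠ k) (hk : k < K) :
    rowSum z g s (c + 1) (some k) t
      = if q < k then rowSum z g s c (some k) (Function.update t c (some q)) else 0 := by
  rw [rowSum_succ z g s c _ t hK, tile_univ]
  simp [TileFits, hc, Tile.south, Tile.west, eastLabel, northLabel, sum_insertNone]
  rw [if_neg hqk, zero_add, sum_eq_single_of_mem k (mem_range.2 hk) fun x _ hx => if_neg (by omega)]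
  simp

end RowSum

section RowSum

variable {R : Type*} [CommRing R]

open Classical in
/-- A pipe leaving to the east turns in its column `b`, and crosses only smaller labels. -/
theorem rowSum_some {K k : ℕ} (z : ℕ → R) (g : (ℕ → Option ℕ) → R) (s : ℕ → Option ℕ) {b : ℕ}
    (hb : s b = some k) (hk : k < K) {c : ℕ} (hbc : b < c)
    (hK : ∀ a < c, ∀ q ∈ s a, q < K) (hinj : ∀ a < c, s a = some k → a = b) (t : ℕ → Option ℕ) :
    rowSum z g s c (some k) t = if ∀ a, b < a → a < c → ∀ q ∈ s a, q < k then
      rowSum z g s b none (fun a => if a = b then none else if a < c then s a else t a) else 0 := by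
  induction c, (show b + 1 ≤ c from hbc) using Nat.le_induction generalizing t with
  | base =>
    rw [rowSum_succ_some_self z g s b t (fun a ha => hK a (by omega)) hb,
      if_pos fun a h1 h2 => by omega]
    refine rowSum_congr z g s b none fun a ha => ?_
    rw [Function.update_apply]
    split_ifs <;> first | rfl | omega
  | succ c hc ih =>
    have IH := fun t => ih (by omega) (fun a ha => hK a (by omega))
      (fun a ha => hinj a (by omega)) t
    have hstep : ∀ t : ℕ → Option ℕ, (fun a => if a = b then none else if a < c then s a
        else Function.update t c (s c) a)
        = fun a => if a = b then none else if a < c + 1 then s a else t a := by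
      intro t
      funext a
      rw [Function.update_apply]
      split_ifs <;> first | rfl | omega | simp_all
    have hK' : ∀ a < c, ∀ q ∈ s a, q < K := fun a ha => hK a (by omega)
    have H := IH (Function.update t c (s c))
    rw [hstep t] at H
    rcases hsc : s c with _ | q <;> rw [hsc] at H
    · rw [rowSum_succ_some_none z g s c t hK' hsc hk, H]
      refine if_congr ⟨fun h a h1 h2 => ?_, fun h a h1 h2 => h a h1 (by omega)⟩ rfl rfl
      rcases (show a < c ∨ a = c by omega) with h3 | rfl
      · exact h a h1 h3
      · simp [hsc]
    · have hqk : q ≠ k := by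
        rintro rfl
        have := hinj c (by omega) hsc
        omega
      rw [rowSum_succ_some_some z g s c t hK' hsc hqk hk]
      by_cases hlt : q < k
      · rw [if_pos hlt, H]
        refine if_congr ⟨fun h a h1 h2 => ?_, fun h a h1 h2 => h a h1 (by omega)⟩ rfl rfl
        rcases (show a < c ∨ a = c by omega) with h3 | rfl
        · exact h a h1 h3
        · simpa [hsc] using hlt
      · rw [if_neg hlt, if_neg]
        exact fun h => hlt (h c (by omega) (by omega) q hsc)

open Classical in
/-- The labels `0, …, i - 1` at the columns `w 0, …, w (i - 1)`. -/
def wordLabels (i : ℕ) (w : ℕ → ℕ) (a : ℕ) : Option ℕ :=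
  if h : ∃ k < i, w k = a then some h.choose else none

theorem wordLabels_eq_some {i : ℕ} {w : ℕ → ℕ} (hw : Set.InjOn w (Set.Iio i)) {a k : ℕ} :
    wordLabels i w a = some k ↔ k < i ∧ w k = a := by
  unfold wordLabels
  constructor
  · intro h
    split_ifs at h with h'
    rw [← Option.some.inj h]
    exact h'.choose_spec
  · intro h
    have h' : ∃ k < i, w k = a := ⟨k, h⟩
    rw [dif_pos h']
    exact congrArg some (hw h'.choose_spec.1 h.1 (h'.choose_spec.2.trans h.2.symm))

theorem wordLabels_eq_none {i : ℕ} {w : ℕ → ℕ} {a : ℕ} :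
    wordLabels i w a = none ↔ ∀ k < i, w k ≠ a := by
  unfold wordLabels
  split_ifs with h
  · simpa using h
  · simpa using h

theorem injOn_update {i : ℕ} {w : ℕ → ℕ} (hw : Set.InjOn w (Set.Iio i)) {k c : ℕ}
    (hc : ∀ e < i, w e ≠ c) : Set.InjOn (Function.update w k c) (Set.Iio i) := by
  intro a ha b hb hab
  rw [Function.update_apply, Function.update_apply] at hab
  split_ifs at hab with h1 h2 h2
  · omega
  · exact absurd hab.symm (hc b hb)
  · exact absurd hab (hc a ha)
  · exact hw ha hb hab

/-- The three cases for column `c` match the recursion of `rowPoly`. For a `j`-tile, `rowSum_some`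
follows the arriving pipe back to the column where it turned, whence the strong induction on `c`. -/
theorem rowSum_eq_rowPoly {i n : ℕ} (z : ℕ → R) {g : (ℕ → Option ℕ) → R} {G : (ℕ → ℕ) → R}
    (hg : ∀ v : ℕ → ℕ, Set.InjOn v (Set.Iio i) → (∀ k < i, v k < n) → g (wordLabels i v) = G v)
    (s : ℕ → Option ℕ) (c : ℕ) : ∀ (w : ℕ → ℕ) (t : ℕ → Option ℕ), c ≤ n →
      Set.InjOn w (Set.Iio i) → (∀ k < i, w k < n) → (∀ a < c, s a = wordLabels i w a) →
      (∀ a, c ≤ a → t a = wordLabels i w a) → rowSum z g s c none t = rowPoly z i G c w := by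
  induction c using Nat.strong_induction_on with
  | _ c ih =>
    intro w t hcn hw hwn hs ht
    cases c with
    | zero =>
      rw [rowSum_zero, rowPoly, ← hg w hw hwn]
      congr 1
      exact funext fun a => ht a (Nat.zero_le _)
    | succ c =>
      have hK : ∀ a < c, ∀ q ∈ s a, q < i := by
        intro a ha q hq
        rw [hs a (by omega)] at hq
        exact ((wordLabels_eq_some hw).1 hq).1
      have hupd : ∀ a, c ≤ a → Function.update t c (s c) a = wordLabels i w a := by
        intro a ha
        rw [Function.update_apply]
        split_ifs with h
        · rw [h, hs c (by omega)]
        · exact ht a (by omega)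
      have hmain := ih c (by omega) w (Function.update t c (s c)) (by omega) hw hwn
        (fun a ha => hs a (by omega)) hupd
      rw [rowPoly]
      rcases hsc : s c with _ | q <;> rw [hsc] at hmain
      · have hno : ∀ k < i, w k ≠ c := by
          rw [← wordLabels_eq_none, ← hs c (by omega), hsc]
        rw [if_neg (by push Not; exact hno), rowSum_succ_none_none z g s c t hK hsc, hmain]
        congr 1
        refine sum_congr rfl fun k hk => ?_
        have hki := mem_range.1 hk
        by_cases hkc : w k < c
        · have hsk : ∀ a < c, (s a = some k ↔ w k = a) := by
            intro a ha
            rw [hs a (by omega), wordLabels_eq_some hw]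
            exact and_iff_right hki
          rw [rowSum_some z g s ((hsk _ hkc).2 rfl) hki hkc hK
            (fun a ha h => ((hsk a ha).1 h).symm)]
          have hiff : (∀ a, w k < a → a < c → ∀ q ∈ s a, q < k) ↔
              (w k < c ∧ ∀ e, k < e → e < i → w e ≤ w k ∨ c ≤ w e) := by
            constructor
            · refine fun h => ⟨hkc, fun e h1 h2 => ?_⟩
              by_contra hc
              rw [not_or, not_le, not_le] at hc
              have := h (w e) hc.1 hc.2 e
                (by rw [hs _ (by omega)]; exact (wordLabels_eq_some hw).2 ⟨h2, rfl⟩)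
              omega
            · rintro ⟨-, h⟩ a h1 h2 q hq
              rw [hs _ (by omega)] at hq
              obtain ⟨h3, rfl⟩ := (wordLabels_eq_some hw).1 hq
              by_contra hc
              rcases (not_lt.1 hc).eq_or_lt with h4 | h4
              · subst h4; omega
              · have := h q h4 h3
                omega
          by_cases hcond : w k < c ∧ ∀ e, k < e → e < i → w e ≤ w k ∨ c ≤ w e
          · rw [if_pos (hiff.2 hcond), dif_pos hcond]
            have hinj' := injOn_update hw (k := k) hno
            have hlab : ∀ a, a ≠ w k → a ≠ c →
                wordLabels i (Function.update w k c) a = wordLabels i w a := by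
              intro a h1 h2
              apply Option.ext
              intro e
              rw [wordLabels_eq_some hinj', wordLabels_eq_some hw,
                Function.update_apply]
              split_ifs with h3
              · subst h3; simp [h1.symm, h2.symm]
              · rfl
            have hlabk : wordLabels i (Function.update w k c) (w k) = none := by
              rw [wordLabels_eq_none]
              intro e he h
              rw [Function.update_apply] at h
              split_ifs at h with h3
              · omega
              · exact h3 (hw he hki h)
            have hlabc : wordLabels i (Function.update w k c) c = some k := by
              rw [wordLabels_eq_some hinj']
              simp [hki]
            refine ih (w k) (by omega) _ _ (by omega) hinj' ?_ ?_ ?_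
            · intro e he
              rw [Function.update_apply]
              split_ifs
              · omega
              · exact hwn e he
            · intro a ha
              rw [hs a (by omega), hlab a (by omega) (by omega)]
            · intro a ha
              by_cases h1 : a = w k
              · rw [if_pos h1, h1, hlabk]
              rw [if_neg h1]
              by_cases h2 : a < c
              · rw [if_pos h2, hs a (by omega), hlab a h1 (by omega)]
              rw [if_neg h2, Function.update_apply]
              by_cases h3 : a = c
              · rw [if_pos h3, h3, hlabc]
              · rw [if_neg h3, ht a (by omega), hlab a h1 h3]
          · rw [if_neg (fun h => hcond (hiff.1 h)), dif_neg hcond]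
        · rw [dif_neg (fun h => hkc h.1), rowSum_eq_zero]
          intro a ha h
          rw [hs a (by omega), wordLabels_eq_some hw] at h
          omega
      · have hq : q < i ∧ w q = c := by
          rw [← wordLabels_eq_some hw, ← hs c (by omega), hsc]
        rw [if_pos ⟨q, hq⟩, rowSum_succ_none_some z g s c t hK hsc, hmain]

/-- The conditions on a row `i` of a bumpless pipe dream entered from the south by the
labels `s`. -/
def RowFits (n i : ℕ) (ρ : ℕ → Tile) (s : ℕ → Option ℕ) : Prop :=
  (∀ a < n, TileFits (ρ a) (s a) (rowWest ρ s a)) ∧ rowWest ρ s n = some i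

/-- The conditions on the rows above row `i`, entered from the south by the labels `s`. -/
def StackFits (n : ℕ) : ℕ → (ℕ → ℕ → Tile) → (ℕ → Option ℕ) → Prop
  | 0, _, s => ∀ a < n, s a = none
  | i + 1, D, s => RowFits n i (D i) s ∧ StackFits n i D (rowNorth (D i) s)

theorem StackFits.congr {n i : ℕ} {D D' : ℕ → ℕ → Tile} (h : ∀ k < i, D k = D' k) :
    ∀ s, StackFits n i D s ↔ StackFits n i D' s := by
  induction i with
  | zero => intro s; rfl
  | succ i ih =>
    intro s
    rw [StackFits, StackFits, h i (by omega), ih fun k hk => h k (by omega)]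

/-- The tiles of the first rows of the grid, continued by blank tiles. -/
def tiles {n i : ℕ} (D : Fin i → Fin n → Tile) (k : ℕ) : ℕ → Tile :=
  extend .blank (extend (fun _ => .blank) D k)

open Classical in
/-- The weight sum of the fillings of the first `i` rows, entered from the south by the
labels `s`. -/
def stackSum (x y : ℕ → R) (n i : ℕ) (s : ℕ → Option ℕ) : R :=
  ∑ D : Fin i → Fin n → Tile, if StackFits n i (tiles D) s then
    ∏ k ∈ range i, ∏ a ∈ range n, (if tiles D k a = .blank then x k - y a else 1) else 0

theorem stackSum_succ (x y : ℕ → R) (n i : ℕ) (s : ℕ → Option ℕ) :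
    stackSum x y n (i + 1) s
      = rowSum (fun a => x i - y a) (stackSum x y n i) s n (some i) (fun _ => none) := by
  classical
  rw [stackSum, sum_fin_succ_fun, rowSum]
  refine sum_congr rfl fun ρ _ => ?_
  have e1 : ∀ (D : Fin i → Fin n → Tile), ∀ k < i,
      tiles (Fin.snoc D ρ : Fin (i + 1) → Fin n → Tile) k = tiles D k := by
    intro D k hk
    rw [tiles, extend_snoc_of_lt _ _ _ hk, tiles]
  have e2 : ∀ (D : Fin i → Fin n → Tile),
      tiles (Fin.snoc D ρ : Fin (i + 1) → Fin n → Tile) i = extend .blank ρ := by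
    intro D
    rw [tiles, extend_snoc_self]
  have e3 : (fun a => if a < n then rowNorth (extend .blank ρ) s a else none)
      = rowNorth (extend .blank ρ) s := by
    funext a
    split_ifs with h
    · rfl
    · rw [rowNorth, extend_of_le _ _ (not_lt.1 h), northLabel]
  rw [e3]
  have e4 : ∀ D : Fin i → Fin n → Tile,
      StackFits n (i + 1) (tiles (Fin.snoc D ρ : Fin (i + 1) → Fin n → Tile)) s ↔
        RowFits n i (extend .blank ρ) s ∧
          StackFits n i (tiles D) (rowNorth (extend .blank ρ) s) := by
    intro D
    rw [StackFits, e2, StackFits.congr (e1 D)]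
  by_cases hrow : RowFits n i (extend .blank ρ) s
  · rw [if_pos (show _ ∧ _ from hrow), stackSum, mul_sum]
    refine sum_congr rfl fun D _ => ?_
    by_cases hD : StackFits n i (tiles D) (rowNorth (extend .blank ρ) s)
    · rw [if_pos ((e4 D).2 ⟨hrow, hD⟩), if_pos hD, prod_range_succ, e2, mul_comm]
      congr 1
      exact prod_congr rfl fun k hk => by rw [e1 D k (mem_range.1 hk)]
    · rw [if_neg (fun h => hD ((e4 D).1 h).2), if_neg hD, mul_zero]
  · rw [if_neg (show ¬ (_ ∧ _) from hrow)]
    exact sum_eq_zero fun D _ => if_neg fun h => hrow ((e4 D).1 h).1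

/-- Pipe `i` leaves row `i` and has the largest label entering it, so the crossing condition of
`rowSum_some` holds automatically to the right of column `w i`. -/
theorem stackSum_wordLabels (x y : ℕ → R) (n i : ℕ) : ∀ w : ℕ → ℕ, Set.InjOn w (Set.Iio i) →
    (∀ k < i, w k < n) → stackSum x y n i (wordLabels i w) = wordPoly x y i w := by
  induction i with
  | zero =>
    intro w _ _
    have : StackFits n 0 (tiles (default : Fin 0 → Fin n → Tile)) (wordLabels 0 w) := by
      intro a _
      rw [wordLabels_eq_none]
      intro k hk
      omega
    rw [stackSum, Fintype.sum_unique, if_pos this, wordPoly, range_zero, prod_empty]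
  | succ i ih =>
    intro w hw hwn
    have hw' : Set.InjOn w (Set.Iio i) := hw.mono fun a (ha : a < i) => show a < i + 1 by omega
    have hlab : ∀ a, a ≠ w i → wordLabels (i + 1) w a = wordLabels i w a := by
      intro a ha
      apply Option.ext
      intro k
      rw [wordLabels_eq_some hw, wordLabels_eq_some hw']
      constructor
      · rintro ⟨h1, rfl⟩
        exact ⟨by have : k ≠ i := fun h => ha (by rw [h]); omega, rfl⟩
      · rintro ⟨h1, h2⟩
        exact ⟨by omega, h2⟩
    have hself : wordLabels i w (w i) = none := by
      rw [wordLabels_eq_none]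
      intro k hk h
      have := hw (show k < i + 1 by omega) (show i < i + 1 by omega) h
      omega
    have hwi := hwn i (by omega)
    rw [stackSum_succ, rowSum_some (K := i + 1) _ _ _
      ((wordLabels_eq_some hw).2 ⟨Nat.lt_succ_self i, rfl⟩) (Nat.lt_succ_self i) hwi
      (fun a _ q hq => ((wordLabels_eq_some hw).1 hq).1)
      (fun a _ h => ((wordLabels_eq_some hw).1 h).2.symm), if_pos, wordPoly]
    · refine rowSum_eq_rowPoly (n := n) _ ih _ (w i) w _ hwi.le hw' (fun k hk => hwn k (by omega))
        (fun a ha => hlab a (by omega)) fun a ha => ?_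
      by_cases h1 : a = w i
      · rw [if_pos h1, h1, hself]
      rw [if_neg h1]
      by_cases h2 : a < n
      · rw [if_pos h2, hlab a h1]
      · rw [if_neg h2, eq_comm, wordLabels_eq_none]
        intro k hk
        have := hwn k (by omega)
        omega
    · intro a h1 _ q hq
      obtain ⟨h3, rfl⟩ := (wordLabels_eq_some hw).1 hq
      have : q ≠ i := fun h => by subst h; omega
      omega

end RowSum

-- Order of the pipes within one row.

section Rows

/-- The tile has strands to the south and to the west exactly where pipes arrive. -/
def Occupied (τ : Tile) (s w : Option ℕ) : Prop := s.isSome = τ.south ∧ w.isSome = τ.west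

theorem Occupied.north {τ : Tile} {s w : Option ℕ} (h : Occupied τ s w) :
    (northLabel τ s w).isSome = τ.north := by
  obtain ⟨h1, h2⟩ := h
  cases τ <;> simp_all [northLabel, Tile.north, Tile.south, Tile.west]

theorem Occupied.east {τ : Tile} {s w : Option ℕ} (h : Occupied τ s w) :
    (eastLabel τ s w).isSome = τ.east := by
  obtain ⟨h1, h2⟩ := h
  cases τ <;> simp_all [eastLabel, Tile.east, Tile.south, Tile.west]

theorem Occupied.south_label {τ : Tile} {s w : Option ℕ} (h : Occupied τ s w) {p : ℕ}
    (hs : s = some p) : northLabel τ s w = some p ∨ eastLabel τ s w = some p := by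
  obtain ⟨h1, h2⟩ := h
  cases τ <;> simp_all [eastLabel, northLabel, Tile.south, Tile.west]

theorem Occupied.west_label {τ : Tile} {s w : Option ℕ} (h : Occupied τ s w) {p : ℕ}
    (hw : w = some p) : northLabel τ s w = some p ∨ eastLabel τ s w = some p := by
  obtain ⟨h1, h2⟩ := h
  cases τ <;> simp_all [eastLabel, northLabel, Tile.south, Tile.west]

theorem Occupied.eq_cross {τ : Tile} {s w : Option ℕ} (h : Occupied τ s w) {p q : ℕ}
    (hs : s = some q) (hw : w = some p) : τ = .cross := by
  obtain ⟨h1, h2⟩ := h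
  cases τ <;> simp_all [Tile.south, Tile.west]

/-- No label occurs twice in the first `n` columns. -/
def LabelsInj (n : ℕ) (s : ℕ → Option ℕ) : Prop :=
  ∀ a b p, a < n → b < n → s a = some p → s b = some p → a = b

variable {n : ℕ} {ρ : ℕ → Tile} {s : ℕ → Option ℕ}

theorem rowNorth_eq_some {a p : ℕ} (h : rowNorth ρ s a = some p) : ∃ b ≤ a, s b = some p := by
  rcases northLabel_eq_some h with h | h
  · exact ⟨a, le_rfl, h⟩
  · obtain ⟨b, hb, h⟩ := rowWest_eq_some h
    exact ⟨b, hb.le, h⟩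

/-- The labels along a cut of a row: north edges up to column `c`, then the west edge of
column `c`, then south edges. -/
theorem labelsInj_cut (hs : LabelsInj n s) {c : ℕ} (hc : c ≤ n) :
    LabelsInj n (fun a => if a < c then rowNorth ρ s a else s a) ∧
      ∀ a p, a < n → (if a < c then rowNorth ρ s a else s a) = some p →
        rowWest ρ s c ≠ some p := by
  induction c with
  | zero => simpa [rowWest] using hs
  | succ c ih =>
    obtain ⟨h1, h2⟩ := ih (by omega)
    have h3 : ∀ a p, a < n → a ≠ c → (if a < c + 1 then rowNorth ρ s a else s a) = some p →
        (s c ≠ some p ∧ rowWest ρ s c ≠ some p) := by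
      intro a p han hac h
      have h' : (if a < c then rowNorth ρ s a else s a) = some p := by
        rw [← h]
        split_ifs <;> first | rfl | omega
      refine ⟨fun h'' => hac (h1 a c p han (by omega) h' ?_), h2 a p han h'⟩
      simpa using h''
    have h4 : ∀ p, s c = some p → rowWest ρ s c ≠ some p := by
      intro p hp
      exact h2 c p (by omega) (by simpa using hp)
    refine ⟨fun a b p ha hb hap hbp => ?_, fun a p ha hap hw => ?_⟩
    · by_contra hab
      by_cases hac : a = c
      · have hb' := h3 b p hb (by omega) hbp
        simp only [hac, Nat.lt_succ_self, if_true] at hap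
        rcases northLabel_eq_some hap with h | h
        · exact hb'.1 h
        · exact hb'.2 h
      · have ha' := h3 a p ha hac hap
        by_cases hbc : b = c
        · simp only [hbc, Nat.lt_succ_self, if_true] at hbp
          rcases northLabel_eq_some hbp with h | h
          · exact ha'.1 h
          · exact ha'.2 h
        · refine hab (h1 a b p ha hb ?_ ?_)
          · simp only at hap ⊢
            rw [← hap]
            split_ifs <;> first | rfl | omega
          · simp only at hbp ⊢
            rw [← hbp]
            split_ifs <;> first | rfl | omega
    · rw [rowWest] at hw
      by_cases hac : a = c
      · simp only [hac, Nat.lt_succ_self, if_true, rowNorth] at hap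
        have := h4 p
        generalize ρ c = τ at *
        cases τ <;> simp_all [northLabel, eastLabel]
      · have ha' := h3 a p ha hac hap
        rcases eastLabel_eq_some hw with h | h
        · exact ha'.1 h
        · exact ha'.2 h

theorem labelsInj_rowNorth (hs : LabelsInj n s) : LabelsInj n (rowNorth ρ s) := by
  intro a b p ha hb hap hbp
  exact (labelsInj_cut hs le_rfl).1 a b p ha hb (by simpa [ha] using hap) (by simpa [hb] using hbp)

theorem rowNorth_ne_rowWest (hs : LabelsInj n s) {a p : ℕ} (ha : a < n)
    (h : rowNorth ρ s a = some p) : rowWest ρ s n ≠ some p :=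
  (labelsInj_cut hs le_rfl).2 a p ha (by simpa [ha] using h)

variable (hocc : ∀ a < n, Occupied (ρ a) (s a) (rowWest ρ s a))
include hocc

theorem rowWest_continues {p c d : ℕ} (hcd : c ≤ d) (hd : d ≤ n) (h : rowWest ρ s c = some p) :
    rowWest ρ s d = some p ∨ ∃ a, c ≤ a ∧ a < d ∧ rowNorth ρ s a = some p := by
  induction d, hcd using Nat.le_induction with
  | base => exact Or.inl h
  | succ d hcd ih =>
    rcases ih (by omega) with h' | ⟨a, h1, h2, h3⟩
    · rcases (hocc d (by omega)).west_label h' with h'' | h''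
      · exact Or.inr ⟨d, hcd, by omega, h''⟩
      · exact Or.inl h''
    · exact Or.inr ⟨a, h1, by omega, h3⟩

theorem south_continues {p c d : ℕ} (hcd : c < d) (hd : d ≤ n) (h : s c = some p) :
    rowWest ρ s d = some p ∨ ∃ a, c ≤ a ∧ a < d ∧ rowNorth ρ s a = some p := by
  rcases (hocc c (by omega)).south_label h with h' | h'
  · exact Or.inr ⟨c, le_rfl, hcd, h'⟩
  · rcases rowWest_continues hocc (show c + 1 ≤ d by omega) hd h' with h'' | ⟨a, h1, h2, h3⟩
    · exact Or.inl h''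
    · exact Or.inr ⟨a, by omega, h2, h3⟩

/-- Two pipes that do not cross in a row keep their order. -/
theorem rowNorth_order {p q a b : ℕ} (hab : a < b) (hb : b < n) (hp : s a = some p)
    (hq : s b = some q) (hcross : ¬ (ρ b = .cross ∧ rowWest ρ s b = some p))
    (hend : rowWest ρ s n ≠ some q) :
    ∃ a' b', a' < b' ∧ b' < n ∧ rowNorth ρ s a' = some p ∧ rowNorth ρ s b' = some q := by
  rcases south_continues hocc hab hb.le hp with h | ⟨a', h1, h2, h3⟩
  · exact absurd ⟨(hocc b hb).eq_cross hq h, h⟩ hcross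
  · rcases south_continues hocc hb le_rfl hq with h | ⟨b', h4, h5, h6⟩
    · exact absurd h hend
    · exact ⟨a', b', by omega, h5, h3, h6⟩

/-- Two pipes that cross in a row exchange their order. -/
theorem rowNorth_order_of_cross {p q b : ℕ} (hb : b < n) (hρ : ρ b = .cross)
    (hp : rowWest ρ s b = some p) (hq : s b = some q) (hend : rowWest ρ s n ≠ some p) :
    ∃ a' b', a' < b' ∧ b' < n ∧ rowNorth ρ s a' = some q ∧ rowNorth ρ s b' = some p := by
  have h1 : rowNorth ρ s b = some q := by rw [rowNorth, hρ]; exact hq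
  have h2 : rowWest ρ s (b + 1) = some p := by rw [rowWest, hρ]; exact hp
  rcases rowWest_continues hocc (show b + 1 ≤ n by omega) le_rfl h2 with h | ⟨a, h3, h4, h5⟩
  · exact absurd h hend
  · exact ⟨b, a, by omega, h4, h1, h5⟩

end Rows

-- Order of the pipes across rows, and reducedness as a local condition.

section Lines

variable {n : ℕ} {T : ℕ → ℕ → Tile} {L : ℕ → ℕ → Option ℕ}

/-- The rows `T` are occupied by the pipes with the labels `L i` on the line above row `i`, and the
pipe `i` leaves row `i`. -/
structure LineSystem (n : ℕ) (T : ℕ → ℕ → Tile) (L : ℕ → ℕ → Option ℕ) : Prop where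
  line : ∀ i < n, L i = rowNorth (T i) (L (i + 1))
  occupied : ∀ i < n, ∀ a < n, Occupied (T i a) (L (i + 1) a) (rowWest (T i) (L (i + 1)) a)
  leaves : ∀ i < n, rowWest (T i) (L (i + 1)) n = some i
  inj : LabelsInj n (L n)
  lt : ∀ a < n, ∀ p, L n a = some p → p < n

/-- On the line above row `i`, pipe `p` is to the left of pipe `q`. -/
def LeftOf (n : ℕ) (L : ℕ → ℕ → Option ℕ) (i p q : ℕ) : Prop :=
  ∃ a b, a < b ∧ b < n ∧ L i a = some p ∧ L i b = some q

/-- In the tile `(i, j)`, pipe `p` runs horizontally and pipe `q` vertically. -/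
def CrossesAt (T : ℕ → ℕ → Tile) (L : ℕ → ℕ → Option ℕ) (p q i j : ℕ) : Prop :=
  T i j = .cross ∧ rowWest (T i) (L (i + 1)) j = some p ∧ L (i + 1) j = some q

theorem leftOf_of_crossesAt {p q i j : ℕ} (hj : j < n) (h : CrossesAt T L p q i j) :
    LeftOf n L (i + 1) p q := by
  obtain ⟨a, ha, h'⟩ := rowWest_eq_some h.2.1
  exact ⟨a, j, ha, hj, h', h.2.2⟩

namespace LineSystem

variable (H : LineSystem n T L)
include H

theorem inj_lt {i : ℕ} (hi : i ≤ n) :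
    LabelsInj n (L i) ∧ ∀ a < n, ∀ p, L i a = some p → p < i := by
  induction hi using Nat.decreasingInduction with
  | self => exact ⟨H.inj, H.lt⟩
  | of_succ i hi ih =>
    rw [H.line i hi]
    refine ⟨labelsInj_rowNorth ih.1, fun a ha p h => ?_⟩
    obtain ⟨b, hb, h'⟩ := rowNorth_eq_some h
    have h1 := ih.2 b (by omega) p h'
    have h2 : p ≠ i := by
      rintro rfl
      exact rowNorth_ne_rowWest ih.1 ha h (H.leaves p hi)
    omega

theorem leftOf_asymm {i p q : ℕ} (hi : i ≤ n) (h : LeftOf n L i p q) : ¬ LeftOf n L i q p := by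
  obtain ⟨a, b, h1, h2, h3, h4⟩ := h
  rintro ⟨c, d, h5, h6, h7, h8⟩
  have h9 := (H.inj_lt hi).1 a d p (by omega) h6 h3 h8
  have h10 := (H.inj_lt hi).1 b c q h2 (by omega) h4 h7
  omega

/-- The left pipe cannot leave to the east without crossing the right one. Only the right pipe needs
to be kept inside, which `q < k` does. -/
theorem leftOf_persists {i k p q : ℕ} (hki : k ≤ i) (hi : i ≤ n) (h : LeftOf n L i p q)
    (hq : q < k) (hno : ∀ i', k ≤ i' → i' < i → ∀ j < n, ¬ CrossesAt T L p q i' j) :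
    LeftOf n L k p q := by
  induction hki using Nat.decreasingInduction with
  | self => exact h
  | of_succ k hk ih =>
    obtain ⟨a, b, h1, h2, h3, h4⟩ := ih (by omega) fun i' h5 => hno i' (by omega)
    have hkn : k < n := by omega
    unfold LeftOf
    rw [H.line k hkn]
    refine rowNorth_order (H.occupied k hkn) h1 h2 h3 h4
      (fun h5 => hno k le_rfl hk b h2 ⟨h5.1, h5.2, h4⟩) ?_
    rw [H.leaves k hkn]
    intro h5
    have := Option.some.inj h5
    omega

theorem leftOf_after_cross {p q i j : ℕ} (hi : i < n) (hj : j < n) (h : CrossesAt T L p q i j)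
    (hp : p ≠ i) : LeftOf n L i q p := by
  unfold LeftOf
  rw [H.line i hi]
  refine rowNorth_order_of_cross (H.occupied i hi) hj h.1 h.2.1 h.2.2 ?_
  rw [H.leaves i hi]
  exact fun h5 => hp (Option.some.inj h5).symm

theorem lt_of_crossesAt {p q i j : ℕ} (hi : i < n) (hj : j < n) (h : CrossesAt T L p q i j) :
    p < i + 1 ∧ q < i + 1 ∧ p ≠ q := by
  obtain ⟨a, b, h1, h2, h3, h4⟩ := leftOf_of_crossesAt hj h
  have h5 := H.inj_lt (show i + 1 ≤ n from hi)
  refine ⟨h5.2 a (by omega) p h3, h5.2 b h2 q h4, ?_⟩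
  rintro rfl
  have := h5.1 a b p (by omega) h2 h3 h4
  omega

/-- No two pipes cross twice if and only if in each crossing the horizontal pipe has the larger
label. -/
theorem reduced_iff :
    (∀ p q i j i' j', i < n → j < n → i' < n → j' < n → CrossesAt T L p q i j →
      (CrossesAt T L p q i' j' ∨ CrossesAt T L q p i' j') → i = i' ∧ j = j') ↔
    ∀ p q i j, i < n → j < n → CrossesAt T L p q i j → q < p := by
  constructor
  · intro hred p q i j hi hj h
    obtain ⟨h1, h2, h3⟩ := H.lt_of_crossesAt hi hj h
    by_contra hpq
    have hpq' : p < q := by omega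
    have h4 := H.leftOf_after_cross hi hj h (by omega)
    have hqi : q < i := by
      obtain ⟨a, b, h5, h6, h7, h8⟩ := h4
      exact (H.inj_lt hi.le).2 a (by omega) q h7
    -- Pipe `q` is now left of `p` but ends in a lower row, so it must cross `p` again. Without that
    -- crossing it would survive to the line above row `q`, where all labels are below `q`.
    have h5 := H.leftOf_persists hqi.le hi.le h4 hpq' fun i' _ h7 j' h8 h9 => by
      have := (hred p q i j i' j' hi hj (by omega) h8 h (Or.inr h9)).1
      omega
    obtain ⟨a, b, h6, h7, h8, h9⟩ := h5
    have := (H.inj_lt (show q ≤ n by omega)).2 a (by omega) q h8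
    omega
  · intro hlt
    -- After the first crossing `p` is right of `q`. Crossing again with `p` horizontal requires `p`
    -- on the left, and only a crossing with `q` horizontal, excluded by `hlt`, could bring it
    -- there.
    have key : ∀ p q i j i' j', i < n → j < n → i' < n → j' < n → CrossesAt T L p q i j →
        CrossesAt T L p q i' j' → ¬ i' < i := by
      intro p q i j i' j' hi hj hi' hj' h h' hii
      have h1 := hlt p q i j hi hj h
      have h2 := (H.lt_of_crossesAt hi' hj' h').1
      have h3 := H.leftOf_after_cross hi hj h (by omega)
      have h4 := H.leftOf_persists (show i' + 1 ≤ i by omega) hi.le h3 h2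
        fun k _ h5 j'' h6 h7 => by
          have := hlt q p k j'' (by omega) h6 h7
          omega
      exact H.leftOf_asymm (by omega) h4 (leftOf_of_crossesAt hj' h')
    intro p q i j i' j' hi hj hi' hj' h h'
    rcases h' with h' | h'
    · have hii : i = i' := by
        have h1 := key p q i j i' j' hi hj hi' hj' h h'
        have h2 := key p q i' j' i j hi' hj' hi hj h' h
        omega
      subst hii
      exact ⟨rfl, (H.inj_lt (show i + 1 ≤ n from hi)).1 j j' q hj hj' h.2.2 h'.2.2⟩
    · have h1 := hlt p q i j hi hj h
      have h2 := hlt q p i' j' hi' hj' h'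
      omega

end LineSystem

end Lines

-- From bumpless pipe dreams to labelled rows.

/-- The labels on the line `m` rows above the line labelled `s` at the bottom of `n` rows. -/
def labelsAbove (n : ℕ) (T : ℕ → ℕ → Tile) (s : ℕ → Option ℕ) : ℕ → ℕ → Option ℕ
  | 0 => s
  | m + 1 => rowNorth (T (n - 1 - m)) (labelsAbove n T s m)

/-- The labels on the line above row `i` if the bottom line is labelled by `s`. -/
def lineLabels (n : ℕ) (T : ℕ → ℕ → Tile) (s : ℕ → Option ℕ) (i : ℕ) : ℕ → Option ℕ :=
  labelsAbove n T s (n - i)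

theorem lineLabels_self (n : ℕ) (T : ℕ → ℕ → Tile) (s : ℕ → Option ℕ) :
    lineLabels n T s n = s := by
  simp [lineLabels, labelsAbove]

theorem lineLabels_of_lt {n i : ℕ} (hi : i < n) (T : ℕ → ℕ → Tile) (s : ℕ → Option ℕ) :
    lineLabels n T s i = rowNorth (T i) (lineLabels n T s (i + 1)) := by
  unfold lineLabels
  rw [show n - i = (n - (i + 1)) + 1 by omega, labelsAbove,
    show n - 1 - (n - (i + 1)) = i by omega]

theorem stackFits_lineLabels {n i : ℕ} (hi : i ≤ n) (T : ℕ → ℕ → Tile) (s : ℕ → Option ℕ) :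
    StackFits n i T (lineLabels n T s i) ↔
      (∀ k < i, RowFits n k (T k) (lineLabels n T s (k + 1))) ∧
        ∀ a < n, lineLabels n T s 0 a = none := by
  induction i with
  | zero => simp [StackFits]
  | succ i ih =>
    rw [StackFits, ← lineLabels_of_lt hi, ih (by omega), Nat.forall_lt_succ_right]
    tauto

section Grid

variable {n : ℕ} (D : TileGrid n) (π : Equiv.Perm (Fin n))

theorem tiles_fin (i j : Fin n) : tiles D i j = D i j := by
  rw [tiles, extend_fin, extend_fin]

/-- The labels on the line above row `i` of the grid `D`, pipe `π k` being labelled by `k`. -/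
def gridLabels (i : ℕ) : ℕ → Option ℕ :=
  lineLabels n (tiles D) (wordLabels n (permWord π)) i

/-- The label at the south edge of a tile of the grid. -/
def southLabel (i j : Fin n) : Option ℕ := gridLabels D π (i + 1) j

/-- The label at the west edge of a tile of the grid, or at the east border. -/
def westLabel (i : Fin n) (j : ℕ) : Option ℕ :=
  rowWest (tiles D i) (gridLabels D π (i + 1)) j

theorem injOn_permWord : Set.InjOn (permWord π) (Set.Iio n) := (permWord_bijective π).1.injOn

theorem wordLabels_permWord (p : Fin n) : wordLabels n (permWord π) p = some (π⁻¹ p).val := by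
  rw [wordLabels_eq_some (injOn_permWord π)]
  refine ⟨(π⁻¹ p).isLt, ?_⟩
  rw [permWord_fin]
  simp

theorem inv_apply_apply (k : Fin n) : π⁻¹ (π k) = k := by simp

theorem gridLabels_self : gridLabels D π n = wordLabels n (permWord π) := lineLabels_self _ _ _

theorem southLabel_last {i : Fin n} (hi : i.val + 1 = n) (p : Fin n) :
    southLabel D π i p = some (π⁻¹ p).val := by
  rw [southLabel, hi, gridLabels_self, wordLabels_permWord]

theorem southLabel_step {i i' : Fin n} (h : i.val + 1 = i'.val) (j : Fin n) :
    southLabel D π i j = northLabel (D i' j) (southLabel D π i' j) (westLabel D π i' j) := by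
  rw [southLabel, gridLabels, h, lineLabels_of_lt i'.isLt, rowNorth, tiles_fin]
  rfl

theorem southLabel_zero (i j : Fin n) (h : i.val = 0) :
    gridLabels D π 0 j = northLabel (D i j) (southLabel D π i j) (westLabel D π i j) := by
  rw [gridLabels, lineLabels_of_lt (by omega), rowNorth, ← h, tiles_fin]
  rfl

theorem westLabel_zero (i : Fin n) : westLabel D π i 0 = none := rfl

theorem westLabel_step (i j : Fin n) :
    westLabel D π i (j + 1) = eastLabel (D i j) (southLabel D π i j) (westLabel D π i j) := by
  rw [westLabel, rowWest, tiles_fin]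
  rfl

mutual

theorem southLabel_of_entersSouth {p : Fin n} : ∀ {i j : Fin n}, D.EntersSouth p i j →
    southLabel D π i j = some (π⁻¹ p).val
  | _, _, .start i hi => southLabel_last D π hi p
  | _, _, .straight i i' j h hp ht => by
    have := southLabel_of_entersSouth hp
    rw [southLabel_step D π h]
    rcases ht with ht | ht <;> rw [ht] <;> exact this
  | _, _, .turn i i' j h hp ht => by
    have := westLabel_of_entersWest hp
    rw [southLabel_step D π h, ht]
    exact this

theorem westLabel_of_entersWest {p : Fin n} : ∀ {i j : Fin n}, D.EntersWest p i j →
    westLabel D π i j = some (π⁻¹ p).val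
  | _, _, .straight i j j' h hp ht => by
    have := westLabel_of_entersWest hp
    rw [← h, westLabel_step D π]
    rcases ht with ht | ht <;> rw [ht] <;> exact this
  | _, _, .turn i j j' h hp ht => by
    have := southLabel_of_entersSouth hp
    rw [← h, westLabel_step D π, ht]
    exact this

end

theorem entersWest_of_westLabel (i : Fin n) (hS : ∀ (j p : Fin n),
      southLabel D π i j = some (π⁻¹ p).val → D.EntersSouth p i j) (c : ℕ) :
    ∀ (j p : Fin n), j.val = c → westLabel D π i j = some (π⁻¹ p).val → D.EntersWest p i j := by
  induction c with
  | zero => intro j p hj h; rw [hj, westLabel_zero] at h; cases h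
  | succ c ih =>
    intro j p hj h
    have hc : c < n := by omega
    have hstep := westLabel_step D π i ⟨c, hc⟩
    rw [hj] at h
    simp only at hstep
    rw [hstep] at h
    have hjc : (⟨c, hc⟩ : Fin n).val + 1 = j.val := hj.symm
    have hW := ih ⟨c, hc⟩ p rfl
    have hS' := hS ⟨c, hc⟩ p
    rcases ht : D i ⟨c, hc⟩ <;> rw [ht] at h <;> simp only [eastLabel, reduceCtorEq] at h
    · exact .turn i _ j hjc (hS' h) ht
    · exact .straight i _ j hjc (hW h) (Or.inr ht)
    · exact .straight i _ j hjc (hW h) (Or.inl ht)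

theorem entersSouth_of_southLabel (m : ℕ) : ∀ (i j p : Fin n), i.val + 1 + m = n →
    southLabel D π i j = some (π⁻¹ p).val → D.EntersSouth p i j := by
  induction m with
  | zero =>
    intro i j p hi h
    rw [southLabel_last D π hi] at h
    have : π⁻¹ j = π⁻¹ p := Fin.ext (Option.some.inj h)
    rw [π⁻¹.injective this]
    exact .start i hi
  | succ m ih =>
    intro i j p hi h
    have hi' : i.val + 1 < n := by omega
    have hii : i.val + 1 = (⟨i.val + 1, hi'⟩ : Fin n).val := rfl
    have hS := fun j p => ih ⟨i.val + 1, hi'⟩ j p (by simp only; omega)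
    have hW := fun j p => entersWest_of_westLabel D π ⟨i.val + 1, hi'⟩ hS _ j p rfl
    rw [southLabel_step D π hii] at h
    rcases ht : D ⟨i.val + 1, hi'⟩ j <;> rw [ht] at h <;> simp only [northLabel, reduceCtorEq] at h
    · exact .turn i _ j hii (hW j p h) ht
    · exact .straight i _ j hii (hS j p h) (Or.inr ht)
    · exact .straight i _ j hii (hS j p h) (Or.inl ht)

/-- Both sides follow strands upward from the same bottom border, so they agree for every grid,
tiling or not. -/
theorem entersSouth_iff {p i j : Fin n} :
    D.EntersSouth p i j ↔ southLabel D π i j = some (π⁻¹ p).val :=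
  ⟨southLabel_of_entersSouth D π,
    entersSouth_of_southLabel D π (n - (i.val + 1)) i j p (by omega)⟩

theorem entersWest_iff {p i j : Fin n} :
    D.EntersWest p i j ↔ westLabel D π i j = some (π⁻¹ p).val :=
  ⟨westLabel_of_entersWest D π,
    entersWest_of_westLabel D π i (fun _ _ => (entersSouth_iff D π).2) _ j p rfl⟩

theorem endsAt_iff {p i : Fin n} : D.EndsAt p i ↔ westLabel D π i n = some (π⁻¹ p).val := by
  have hn : n - 1 < n := by have := i.isLt; omega
  have hstep := westLabel_step D π i ⟨n - 1, hn⟩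
  simp only [show n - 1 + 1 = n by omega] at hstep
  rw [hstep]
  unfold TileGrid.EndsAt
  constructor
  · rintro ⟨j, hj, h⟩
    obtain rfl : j = ⟨n - 1, hn⟩ := Fin.ext (by simp only; omega)
    rw [entersWest_iff D π, entersSouth_iff D π] at h
    rcases h with ⟨h, ht | ht⟩ | ⟨h, ht⟩ <;> rw [ht] <;> exact h
  · intro h
    refine ⟨⟨n - 1, hn⟩, by simp only; omega, ?_⟩
    rw [entersWest_iff D π, entersSouth_iff D π]
    rcases ht : D i ⟨n - 1, hn⟩ <;> rw [ht] at h <;> simp_all [eastLabel]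

/-- Every tile of the grid is occupied by pipes as its strands require. -/
def GridOccupied : Prop :=
  ∀ i j : Fin n, Occupied (D i j) (southLabel D π i j) (westLabel D π i j)

theorem gridOccupied_of_isTiling (hD : D.IsTiling) : GridOccupied D π := by
  have row : ∀ i : Fin n, (∀ j, (southLabel D π i j).isSome = (D i j).south) →
      ∀ c : ℕ, ∀ j : Fin n, j.val = c → (westLabel D π i j).isSome = (D i j).west := by
    intro i hS c
    induction c with
    | zero => intro j hj; rw [hj, westLabel_zero, hD.west_border i j hj]; rfl
    | succ c ih =>
      intro j hj
      have hc : c < n := by omega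
      have hstep := westLabel_step D π i ⟨c, hc⟩
      simp only at hstep
      rw [hj, hstep, Occupied.east ⟨hS _, ih ⟨c, hc⟩ rfl⟩]
      exact hD.east_west i _ j hj.symm
  have col : ∀ m : ℕ, ∀ i : Fin n, i.val + 1 + m = n →
      ∀ j, (southLabel D π i j).isSome = (D i j).south := by
    intro m
    induction m with
    | zero =>
      intro i hi j
      rw [southLabel_last D π hi, hD.south_border i j hi]
      rfl
    | succ m ih =>
      intro i hi j
      have hi' : i.val + 1 < n := by omega
      have hS := ih ⟨i.val + 1, hi'⟩ (by simp only; omega)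
      rw [southLabel_step D π (i' := ⟨i.val + 1, hi'⟩) rfl,
        Occupied.north ⟨hS j, row _ hS _ j rfl⟩]
      exact (hD.south_north i _ j rfl).symm
  intro i j
  have hS := col (n - (i.val + 1)) i (by omega)
  exact ⟨hS j, row i hS _ j rfl⟩

theorem isTiling_iff (hend : ∀ i : Fin n, (westLabel D π i n).isSome) :
    D.IsTiling ↔ GridOccupied D π ∧ ∀ j : Fin n, gridLabels D π 0 j = none := by
  constructor
  · intro hD
    have hocc := gridOccupied_of_isTiling D π hD
    refine ⟨hocc, fun j => ?_⟩
    have h0 : 0 < n := by have := j.isLt; omega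
    have h1 := southLabel_zero D π ⟨0, h0⟩ j rfl
    have h2 := (hocc ⟨0, h0⟩ j).north
    rw [hD.north_border _ _ rfl, ← h1] at h2
    simpa using h2
  · rintro ⟨hocc, htop⟩
    refine ⟨fun i j j' h => ?_, fun i i' j h => ?_, fun i j h => ?_, fun i j h => ?_,
      fun i j h => ?_, fun i j h => ?_⟩
    · rw [← (hocc i j).east, ← (hocc i j').2, ← h, westLabel_step]
    · rw [← (hocc i' j).north, ← (hocc i j).1, southLabel_step D π h]
    · rw [← (hocc i j).north, ← southLabel_zero D π i j h, htop]
      rfl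
    · rw [← (hocc i j).2, h, westLabel_zero]
      rfl
    · rw [← (hocc i j).1, southLabel_last D π h]
      rfl
    · rw [← (hocc i j).east, ← westLabel_step, h]
      exact hend i

theorem crossAt_iff {p q i j : Fin n} : D.CrossAt p q i j ↔
    CrossesAt (tiles D) (gridLabels D π) (π⁻¹ p).val (π⁻¹ q).val i j := by
  unfold TileGrid.CrossAt CrossesAt
  rw [entersWest_iff D π, entersSouth_iff D π, tiles_fin]
  rfl

theorem lineSystem (hocc : GridOccupied D π) (hend : ∀ i : Fin n, westLabel D π i n = some i.val) :
    LineSystem n (tiles D) (gridLabels D π) where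
  line i hi := lineLabels_of_lt hi _ _
  occupied i hi a ha := by
    have := hocc ⟨i, hi⟩ ⟨a, ha⟩
    rwa [← tiles_fin D ⟨i, hi⟩ ⟨a, ha⟩] at this
  leaves i hi := hend ⟨i, hi⟩
  inj a b p _ _ h1 h2 := by
    rw [gridLabels_self, wordLabels_eq_some (injOn_permWord π)] at h1 h2
    exact h1.2.symm.trans h2.2
  lt a _ p h := by
    rw [gridLabels_self, wordLabels_eq_some (injOn_permWord π)] at h
    exact h.1

theorem isReduced_iff (H : LineSystem n (tiles D) (gridLabels D π)) :
    D.IsReduced ↔ ∀ p q i j, i < n → j < n →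
      CrossesAt (tiles D) (gridLabels D π) p q i j → q < p := by
  rw [← H.reduced_iff]
  constructor
  · intro h p q i j i' j' hi hj hi' hj' h1 h2
    obtain ⟨hp, hq, -⟩ := H.lt_of_crossesAt hi hj h1
    have h3 := h (π ⟨p, by omega⟩) (π ⟨q, by omega⟩) ⟨i, hi⟩ ⟨j, hj⟩ ⟨i', hi'⟩ ⟨j', hj'⟩
    simp only [crossAt_iff D π, inv_apply_apply, Fin.mk.injEq] at h3
    exact h3 h1 h2
  · intro h p q i j i' j' h1 h2
    rw [crossAt_iff D π] at h1
    rw [crossAt_iff D π, crossAt_iff D π] at h2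
    have := h _ _ _ _ _ _ i.isLt j.isLt i'.isLt j'.isLt h1 h2
    exact ⟨Fin.ext this.1, Fin.ext this.2⟩

/-- With exit rows as labels, the global conditions become conditions on single tiles and rows:
tiling is occupancy, the permutation is given by the east ends, and reducedness by the order of
labels in crossings. -/
theorem bpd_iff_stackFits : (D.IsTiling ∧ D.IsReduced ∧ ∀ i, D.EndsAt (π i) i) ↔
    StackFits n n (tiles D) (wordLabels n (permWord π)) := by
  have hS := stackFits_lineLabels (le_refl n) (tiles D) (wordLabels n (permWord π))
  rw [lineLabels_self] at hS
  rw [hS]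
  have hends : (∀ i, D.EndsAt (π i) i) ↔ ∀ i : Fin n, westLabel D π i n = some i.val := by
    refine forall_congr' fun i => ?_
    rw [endsAt_iff D π, inv_apply_apply]
  rw [hends]
  constructor
  · rintro ⟨h1, h2, h3⟩
    rw [isTiling_iff D π fun i => by rw [h3]; rfl] at h1
    have H := lineSystem D π h1.1 h3
    rw [isReduced_iff D π H] at h2
    refine ⟨fun k hk => ⟨fun a ha => ?_, H.leaves k hk⟩, fun a ha => h1.2 ⟨a, ha⟩⟩
    obtain ⟨h4, h5⟩ := H.occupied k hk a ha
    exact ⟨h4, h5, fun h6 p hp q hq => h2 p q k a hk ha ⟨h6, hp, hq⟩⟩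
  · rintro ⟨h1, h2⟩
    have h3 : ∀ i : Fin n, westLabel D π i n = some i.val := fun i => (h1 i i.isLt).2
    have hocc : GridOccupied D π := by
      intro i j
      have h4 := (h1 i i.isLt).1 j j.isLt
      rw [tiles_fin] at h4
      exact ⟨h4.1, h4.2.1⟩
    refine ⟨(isTiling_iff D π fun i => by rw [h3]; rfl).2 ⟨hocc, fun j => h2 j j.isLt⟩, ?_, h3⟩
    rw [isReduced_iff D π (lineSystem D π hocc h3)]
    intro p q i j hi hj h
    exact ((h1 i hi).1 j hj).2.2 h.1 p h.2.1 q h.2.2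

end Grid

-- Double Schubert polynomials as word polynomials, and Monk's rule.

/-- The variable `x_i`, with value zero out of range. -/
def xSeq (n i : ℕ) : XYPoly n := if h : i < n then xVar ⟨i, h⟩ else 0

/-- The variable `y_j`, with value zero out of range. -/
def ySeq (n j : ℕ) : XYPoly n := if h : j < n then yVar ⟨j, h⟩ else 0

theorem xSeq_fin {n : ℕ} (i : Fin n) : xSeq n i = xVar i := by simp [xSeq]

theorem ySeq_fin {n : ℕ} (i : Fin n) : ySeq n i = yVar i := by simp [ySeq]

theorem doubleSchubert_eq_wordPoly {n : ℕ} (π : Equiv.Perm (Fin n)) :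
    doubleSchubert π = wordPoly (xSeq n) (ySeq n) n (permWord π) := by
  classical
  rw [← stackSum_wordLabels _ _ n n _ (injOn_permWord π) fun k hk => by
    lift k to Fin n using hk
    rw [permWord_fin]
    exact (π k).isLt]
  have hweight : ∀ D : TileGrid n, ∏ b ∈ D.blanks, (xVar b.1 - yVar b.2)
      = ∏ k ∈ range n, ∏ a ∈ range n,
        (if tiles D k a = .blank then xSeq n k - ySeq n a else 1) := by
    intro D
    rw [TileGrid.blanks, prod_filter, Fintype.prod_prod_type, prod_range]
    refine prod_congr rfl fun i _ => ?_
    rw [prod_range]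
    refine prod_congr rfl fun j _ => ?_
    rw [tiles_fin, xSeq_fin, ySeq_fin]
  rw [doubleSchubert, stackSum, ← sum_filter]
  refine (sum_congr rfl fun D _ => hweight D.1).trans ?_
  refine sum_bij (fun D _ => D.1) (fun D _ => ?_) (fun D _ D' _ h => Subtype.ext h)
    (fun D hD => ?_) (fun _ _ => rfl)
  · rw [mem_filter]
    exact ⟨mem_univ _, (bpd_iff_stackFits D.1 π).1 D.2⟩
  · exact ⟨⟨D, (bpd_iff_stackFits D π).2 (mem_filter.1 hD).2⟩, mem_univ _, rfl⟩

instance : DecidableEq BlankLabel := fun _ _ => Classical.propDecidable _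

instance : Fintype BlankLabel where
  elems := {.x, .negY}
  complete := by intro b; cases b <;> simp

theorem sum_blankLabel {R : Type*} [AddCommMonoid R] (f : BlankLabel → R) :
    ∑ v, f v = f .x + f .negY :=
  sum_pair (by simp)

instance {n : ℕ} (π : Equiv.Perm (Fin n)) : Fintype (DecoratedBPD π) := by
  classical
  unfold DecoratedBPD
  infer_instance

/-- Expanding the product of the `x_i - y_j` chooses one label for each blank tile. -/
theorem sum_mon {n : ℕ} (π : Equiv.Perm (Fin n)) :
    ∑ E : DecoratedBPD π, E.mon = doubleSchubert π := by
  classical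
  have h : ∀ D : BPD π, ∏ b ∈ D.1.blanks, (xVar b.1 - yVar b.2 : XYPoly n)
      = ∑ f : D.1.blanks → BlankLabel, DecoratedBPD.mon (π := π) ⟨D, f⟩ := by
    intro D
    rw [← prod_coe_sort]
    have h1 : ∀ b : D.1.blanks, (xVar b.1.1 - yVar b.1.2 : XYPoly n)
        = ∑ v ∈ (univ : Finset BlankLabel), v.factor b.1.1 b.1.2 := by
      intro b
      rw [sum_blankLabel, sub_eq_add_neg]
      rfl
    rw [prod_congr rfl fun b _ => h1 b, prod_univ_sum, Fintype.piFinset_univ]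
    rfl
  rw [doubleSchubert, sum_congr rfl fun D _ => h D, ← Fintype.sum_sigma']
  refine Fintype.sum_equiv (Equiv.refl _) _ _ fun _ => rfl

theorem sum_indicator {ι : Type*} [Fintype ι] {p : ι → Prop} [DecidablePred p]
    [Fintype {i // p i}] {R : Type*} [AddCommMonoid R] (f : ι → R) :
    ∑ i, (if p i then f i else 0) = ∑ i : {i // p i}, f i := by
  rw [← sum_filter]
  exact sum_subtype _ (by simp) f

/-- Monk's rule for double Schubert polynomials. -/
theorem monk {n : ℕ} (π : Equiv.Perm (Fin n)) (α : Fin n)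
    (hα : ∃ l : Fin n, α < l ∧ BruhatCovers (π * Equiv.swap α l) π) :
    (xVar α - yVar (π α)) * doubleSchubert π
        + ∑ k : LowerIndex π α, doubleSchubert (π * Equiv.swap k.1 α)
      = ∑ l : UpperIndex π α, doubleSchubert (π * Equiv.swap α l.1) := by
  classical
  -- The word is fixed from `n` on; `n + 2` is the least bound allowed by `B + 1 < N` with `B = n`.
  have hm := monkOp_wordPoly (xSeq n) (ySeq n) n (n + 2) n le_rfl n le_rfl (by omega) (permWord π)
    (permWord_bijective π)
    (fun a b ha hb => by rwa [permWord_of_le π ha, permWord_of_le π (by omega)])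
    (fun e he => permWord_of_le π he) α α.isLt
  obtain ⟨l, hl, hcov⟩ := hα
  rw [bruhatCovers_mul_swap_iff π hl] at hcov
  -- The given cover at `l` blocks all covers leaving `S_n`: its letter exceeds `π α` but is smaller
  -- than every letter at a position `e ≥ n`.
  have hout : ∀ e, n ≤ e → coverSign (permWord π) α e = 0 := by
    intro e he
    rw [coverSign_of_lt _ (by omega), if_neg]
    intro h
    have h1 := h.2.2 l hl (by omega)
    have h2 := hcov.2.1
    rw [permWord_of_le π he] at h1
    simp only [permWord_fin] at h1 h2
    have := (π l).isLt
    omega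
  rw [monkOp, sum_range_succ, sum_range_succ, hout n le_rfl, hout (n + 1) (by omega),
    sum_range] at hm
  have hterm : ∀ e : Fin n, (coverSign (permWord π) α e : XYPoly n)
        * wordPoly (xSeq n) (ySeq n) n (exch (permWord π) α e)
      = (if α < e ∧ BruhatCovers (π * Equiv.swap α e) π then
          doubleSchubert (π * Equiv.swap α e) else 0)
        - (if e < α ∧ BruhatCovers (π * Equiv.swap e α) π then
          doubleSchubert (π * Equiv.swap e α) else 0) := by
    intro e
    rw [Equiv.swap_comm e α, ← permWord_mul_swap, ← doubleSchubert_eq_wordPoly]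
    rcases lt_trichotomy α e with h | rfl | h
    · rw [coverSign_of_lt _ h,
        if_neg (fun h' : e < α ∧ _ => absurd h'.1 h.not_gt)]
      by_cases hc : IsCover (permWord π) α e
      · rw [if_pos hc, if_pos ⟨h, (bruhatCovers_mul_swap_iff π h).2 hc⟩]
        simp
      · rw [if_neg hc, if_neg fun h' => hc ((bruhatCovers_mul_swap_iff π h).1 h'.2)]
        simp
    · simp [coverSign_self]
    · rw [coverSign_swap, coverSign_of_lt _ h,
        if_neg (fun h' : α < e ∧ _ => absurd h'.1 h.not_gt)]
      by_cases hc : IsCover (permWord π) e α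
      · rw [if_pos hc, if_pos ⟨h, by
          rw [Equiv.swap_comm]; exact (bruhatCovers_mul_swap_iff π h).2 hc⟩]
        simp
      · rw [if_neg hc, if_neg fun h' => hc ((bruhatCovers_mul_swap_iff π h).1 (by
          rw [Equiv.swap_comm]; exact h'.2))]
        simp
  rw [sum_congr rfl fun e _ => hterm e, sum_sub_distrib, sum_indicator, sum_indicator,
    ← doubleSchubert_eq_wordPoly, permWord_fin, xSeq_fin, ySeq_fin] at hm
  push_cast at hm
  linear_combination -hm

end MonkBPD

end

theorem mainTheorem2 (n : ℕ) (π : Equiv.Perm (Fin n)) (α : Fin n)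
    (hα : ∃ l : Fin n, α < l ∧ BruhatCovers (π * Equiv.swap α l) π) :
    (∃ Φ : ((BlankLabel × DecoratedBPD π) ⊕
          (Σ k : LowerIndex π α, DecoratedBPD (π * Equiv.swap k.1 α))) ≃
        (Σ l : UpperIndex π α, DecoratedBPD (π * Equiv.swap α l.1)),
      (∀ E : DecoratedBPD π,
        (Φ (Sum.inl (BlankLabel.x, E))).2.mon = xVar α * E.mon) ∧
      (∀ E : DecoratedBPD π,
        (Φ (Sum.inl (BlankLabel.negY, E))).2.mon = - yVar (π α) * E.mon) ∧
      (∀ (k : LowerIndex π α) (E : DecoratedBPD (π * Equiv.swap k.1 α)),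
        (Φ (Sum.inr ⟨k, E⟩)).2.mon = E.mon)) ∧
    (xVar α - yVar (π α)) * doubleSchubert π
        + ∑ k : LowerIndex π α, doubleSchubert (π * Equiv.swap k.1 α)
      = ∑ l : UpperIndex π α, doubleSchubert (π * Equiv.swap α l.1) := by
  classical
  refine ⟨?_, MonkBPD.monk π α hα⟩
  obtain ⟨Φ, hΦ⟩ := MonkBPD.exists_equiv_of_sum_eq
    (A := (BlankLabel × DecoratedBPD π) ⊕
      (Σ k : LowerIndex π α, DecoratedBPD (π * Equiv.swap k.1 α)))
    (B := Σ l : UpperIndex π α, DecoratedBPD (π * Equiv.swap α l.1))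
    -- Multiplication by `x_α` or `-y_{π(α)}` is the factor of an extra blank tile at `(α, π α)`, so
    -- the prescribed weights are again signed monomials.
    (Sum.elim (fun E => E.1.factor α (π α) * E.2.mon) fun E => E.2.mon) (fun E => E.2.mon)
    (by
      rintro (E | E)
      · exact mul_mem (MonkBPD.blankLabel_factor_mem _ _ _) (MonkBPD.mon_mem _)
      · exact MonkBPD.mon_mem _)
    (fun E => MonkBPD.mon_mem _)
    (by
      rw [Fintype.sum_sum_type, Fintype.sum_sigma, Fintype.sum_sigma, Fintype.sum_prod_type]
      simp only [Sum.elim_inl, Sum.elim_inr, ← Finset.mul_sum, MonkBPD.sum_mon]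
      rw [← MonkBPD.monk π α hα,
        MonkBPD.sum_blankLabel, ← add_mul, sub_eq_add_neg]
      rfl)
  exact ⟨Φ, fun E => hΦ _, fun E => hΦ _, fun k E => hΦ _⟩
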